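/- **Setting.** Let $1\le r\le d$, let $\Lambda\in\mathbb R^{d\times d}$ be symmetric positive definite, let $U\in\mathbb R^{d\times r}$ have orthonormal columns and let $U_\perp\in\mathbb R^{d\times(d-r)}$ be an orthonormal complement of $U$ (orthonormal columns, $U^\top U_\perp=0$). Put $\Lambda_{11}=U^\top\Lambda U$, $\Lambda_{12}=U^\top\Lambda U_\perp$, $\Lambda_{22}=U_\perp^\top\Lambda U_\perp$. Let $\beta\sim\mathcal N(0,I_r)$, the demonstration inputs $x_1,\dots,x_M\sim\mathcal N(0,\Lambda)$ and the query $x\sim\mathcal N(0,\Lambda)$ be mutually independent; put $w=U\beta$ and $y_i=\langle w,x_i\rangle$. With $\lambda>0$ and $S=\frac1M\sum_i x_ix_i^\top$, the ridge predictor is $$\hat w_{\mathcal D}=(S+\lambda I_d)^{-1}\frac1M\sum_i x_iy_i,\qquad f_{\mathcal D}(x)=\langle\hat w_{\mathcal D},x\rangle .$$ Let $z=U^\top x$, $t=U_\perp^\top x$, and let $Z\in\mathbb R^{M\times r}$ have rows $(U^\top x_i)^\top$. Put $S_{11}=U^\top SU$, $S_{12}=U^\top SU_\perp$, $S_{21}=S_{12}^\top$,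 $S_{22}=U_\perp^\top SU_\perp$, $A=S_{11}+\lambda I_r$, $B=S_{12}$, $H=S_{22}+\lambda I_{d-r}-S_{21}A^{-1}B$. The concept estimator and the off-subspace leakage are $$\hat\beta_{\mathcal D}=(Z^\top Z+M\lambda I_r)^{-1}Z^\top y,\qquad \Delta_{\mathcal D}(x)=(t^\top-z^\top A^{-1}B)\,\gamma_{\mathcal D},\qquad \gamma_{\mathcal D}=H^{-1}S_{21}(\beta-\hat\beta_{\mathcal D}).$$ For $a_0\ge1$ and $\delta\in(0,1)$ write $$L_\delta=r+\log\frac{a_0}{\delta},\qquad R_\perp(\delta)=\sqrt{\operatorname{tr}\Lambda_{22}}+\sqrt{\|\Lambda_{22}\|_{\rm op}\log\frac{a_0}{\delta}},\qquad \eta_M(\delta)=R_\perp(\delta)\sqrt{\frac{L_\delta}{M}} .$$ **Theorem (Concept-coordinate estimation and off-subspace leakage).** There is a universal constant $a_0\ge1$, and for all $\kappa,\lambda_0>0$ there are constants $K_0,K_\beta,K_\Delta,K_\rho,K_\rho'>0$ depending only on $\kappa$ and $\lambda_0$, such that the following holds for all $1\le r\le d$, $M$, $\Lambda$, $U$, $U_\perp$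 as above with $\lambda_{\min}(\Lambda_{11})\ge\kappa$ and all $\delta\in(0,1)$. (In particular, taking $\kappa=\lambda_{\min}(\Lambda_{11})$, the constants depend only on $\Lambda_{11}$ and $\lambda_0$.) Take $\lambda=\lambda_0/M$ and suppose $M\ge K_0L_\delta$. *(BD)* If $\Lambda_{12}=0$, then with $\eta=\eta_M(\delta)$ and $q=R_\perp(\delta)/\sqrt M$, with probability at least $1-\delta$ over $\beta$, the demonstrations and the query, all of the following hold simultaneously: $$\|\hat\beta_{\mathcal D}-\beta\|\le K_\beta\frac{\sqrt{L_\delta}}{M},\qquad |\Delta_{\mathcal D}(x)|\le K_\Delta(\|t\|+q\|z\|)\,\eta,$$ $$|f_{\mathcal D}(x)-\langle w,x\rangle|\le\|z\|\,\|\hat\beta_{\mathcal D}-\beta\|+|\Delta_{\mathcal D}(x)|,$$ $$|f_{\mathcal D}(x)-\langle w,x\rangle|\le K_\beta\|z\|\frac{\sqrt{L_\delta}}{M}+K_\Delta(\|t\|+q\|z\|)\,\eta,$$ $$|f_{\mathcal D}(x+v)-f_{\mathcal D}(x)|\le K_\Delta\,\eta\,\|v\|\quad\text{for every }v\in\operatorname{span}(U)^\perp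 .$$ *(NBD)* If $\|\Lambda_{12}\|_{\rm op}\le\rho$, then, with probability at least $1-\delta$, the same bounds hold simultaneously with $\eta=\eta_M(\delta)+K_\rho\,\rho\sqrt{L_\delta}$ and $q=R_\perp(\delta)/\sqrt M+K_\rho'\,\rho$. -/

import Mathlib

open MeasureTheory ProbabilityTheory
open scoped Matrix Matrix.Norms.L2Operator RealInnerProductSpace

noncomputable section

namespace ConceptICL

/-- Euclidean space of column vectors of length `n`. -/
abbrev Vec (n : ℕ) := EuclideanSpace ℝ (Fin n)

/-- Matrix times column vector, between Euclidean spaces. -/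
def act {m n : ℕ} (A : Matrix (Fin m) (Fin n) ℝ) (v : Vec n) : Vec m :=
  WithLp.toLp 2 (A *ᵥ v.ofLp)

/-- The column span of `U`, i.e. the concept subspace. -/
def colSpan {d r : ℕ} (U : Matrix (Fin d) (Fin r) ℝ) : Submodule ℝ (Vec d) :=
  Submodule.span ℝ (Set.range fun j : Fin r => (WithLp.toLp 2 (fun i => U i j) : Vec d))

/-- `V` is an orthonormal complement of the matrix `U` with orthonormal columns:
the columns of `[U V]` form an orthonormal basis of `ℝ^d`. -/
structure IsOrthonormalComplement {d r : ℕ} (U : Matrix (Fin d) (Fin r) ℝ)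
    (V : Matrix (Fin d) (Fin (d - r)) ℝ) : Prop where
  le : r ≤ d
  orthonormal : Uᵀ * U = 1
  orthonormal_compl : Vᵀ * V = 1
  orthogonal : Uᵀ * V = 0

/-! ### The data model -/

/-- Joint law of (task coordinate `β`, demonstration inputs `x_1, …, x_M`, query `x`):
all independent, `β ~ N(0, I_r)`, `x_i ~ N(0, Λ)` and `x ~ N(0, Λ)`. -/
def dataLaw (r d M : ℕ) (Lam : Matrix (Fin d) (Fin d) ℝ) :
    Measure (Vec r × (Fin M → Vec d) × Vec d) :=
  (multivariateGaussian (0 : Vec r) (1 : Matrix (Fin r) (Fin r) ℝ)).prod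
    ((Measure.pi fun _ : Fin M => multivariateGaussian (0 : Vec d) Lam).prod
      (multivariateGaussian (0 : Vec d) Lam))

/-- Noiseless labels `y_i = ⟨w, x_i⟩`. -/
def labels {d M : ℕ} (w : Vec d) (X : Fin M → Vec d) : Fin M → ℝ := fun i => ⟪w, X i⟫

/-! ### Ridge regression in the ambient space -/

/-- The empirical covariance `S = (1/M) ∑ x_i x_iᵀ`. -/
def empCov {d M : ℕ} (X : Fin M → Vec d) : Matrix (Fin d) (Fin d) ℝ :=
  (1 / (M : ℝ)) • ∑ i, Matrix.vecMulVec (X i).ofLp (X i).ofLp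

/-- The ridge estimator `(S + λ I)⁻¹ ((1/M) ∑ x_i y_i)`. -/
def ridge {d M : ℕ} (lam : ℝ) (X : Fin M → Vec d) (y : Fin M → ℝ) : Vec d :=
  act (empCov X + lam • (1 : Matrix (Fin d) (Fin d) ℝ))⁻¹ ((1 / (M : ℝ)) • ∑ i, y i • X i)

/-- The ridge predictor `f_D(x) = ⟨ŵ_D, x⟩`. -/
def predictor {d M : ℕ} (lam : ℝ) (X : Fin M → Vec d) (y : Fin M → ℝ) (x : Vec d) : ℝ :=
  ⟪ridge lam X y, x⟫

/-! ### Concept-space ridge regression and off-subspace leakage -/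

/-- The `M × r` matrix `Z` whose rows are the concept coordinates `z_i = Uᵀ x_i`. -/
def conceptDesign {d r M : ℕ} (U : Matrix (Fin d) (Fin r) ℝ) (X : Fin M → Vec d) :
    Matrix (Fin M) (Fin r) ℝ :=
  Matrix.of fun i => (act Uᵀ (X i)).ofLp

/-- The concept-coordinate estimator `β̂_D = (Zᵀ Z + M λ I)⁻¹ Zᵀ y`. -/
def conceptRidge {d r M : ℕ} (U : Matrix (Fin d) (Fin r) ℝ) (lam : ℝ) (X : Fin M → Vec d)
    (y : Fin M → ℝ) : Vec r :=
  act ((conceptDesign U X)ᵀ * conceptDesign U X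
      + ((M : ℝ) * lam) • (1 : Matrix (Fin r) (Fin r) ℝ))⁻¹
    (WithLp.toLp 2 ((conceptDesign U X)ᵀ *ᵥ y))

/-- `A = S₁₁ + λ I`. -/
def blockA {d r M : ℕ} (U : Matrix (Fin d) (Fin r) ℝ) (lam : ℝ) (X : Fin M → Vec d) :
    Matrix (Fin r) (Fin r) ℝ :=
  Uᵀ * empCov X * U + lam • (1 : Matrix (Fin r) (Fin r) ℝ)

/-- `B = S₁₂`; its transpose is `S₂₁`. -/
def blockB {d r m M : ℕ} (U : Matrix (Fin d) (Fin r) ℝ) (V : Matrix (Fin d) (Fin m) ℝ)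
    (X : Fin M → Vec d) : Matrix (Fin r) (Fin m) ℝ :=
  Uᵀ * empCov X * V

/-- The Schur complement `H = D - S₂₁ A⁻¹ B` with `D = S₂₂ + λ I`. -/
def schurH {d r m M : ℕ} (U : Matrix (Fin d) (Fin r) ℝ) (V : Matrix (Fin d) (Fin m) ℝ)
    (lam : ℝ) (X : Fin M → Vec d) : Matrix (Fin m) (Fin m) ℝ :=
  (Vᵀ * empCov X * V + lam • (1 : Matrix (Fin m) (Fin m) ℝ))
    - (blockB U V X)ᵀ * (blockA U lam X)⁻¹ * blockB U V X

/-- `γ_D = H⁻¹ S₂₁ (β - β̂_D)`, for the labels generated by `w = U β`. -/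
def offCoord {d r m M : ℕ} (U : Matrix (Fin d) (Fin r) ℝ) (V : Matrix (Fin d) (Fin m) ℝ)
    (lam : ℝ) (beta : Vec r) (X : Fin M → Vec d) : Vec m :=
  act ((schurH U V lam X)⁻¹ * (blockB U V X)ᵀ)
    (beta - conceptRidge U lam X (labels (act U beta) X))

/-- The off-subspace leakage `Δ_D(x) = (tᵀ - zᵀ A⁻¹ B) γ_D`, where `z = Uᵀ x`, `t = Vᵀ x`. -/
def leakage {d r m M : ℕ} (U : Matrix (Fin d) (Fin r) ℝ) (V : Matrix (Fin d) (Fin m) ℝ)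
    (lam : ℝ) (beta : Vec r) (X : Fin M → Vec d) (x : Vec d) : ℝ :=
  ⟪act Vᵀ x, offCoord U V lam beta X⟫
    - ⟪act Uᵀ x, act ((blockA U lam X)⁻¹ * blockB U V X) (offCoord U V lam beta X)⟫

/-! ### Rates -/

/-- `L_δ = r + log (a₀ / δ)`. -/
def effDim (a₀ : ℝ) (r : ℕ) (δ : ℝ) : ℝ := r + Real.log (a₀ / δ)

/-- `R_⊥(δ) = √(tr Λ₂₂) + √(‖Λ₂₂‖ log (a₀ / δ))`; the norm is the spectral operator norm. -/
def nuisanceRadius {m : ℕ} (a₀ : ℝ) (Lam22 : Matrix (Fin m) (Fin m) ℝ) (δ : ℝ) : ℝ :=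
  √Lam22.trace + √(‖Lam22‖ * Real.log (a₀ / δ))

/-- `η_M(δ) = R_⊥(δ) √(L_δ / M)`. -/
def nuisanceRate {m : ℕ} (a₀ : ℝ) (Lam22 : Matrix (Fin m) (Fin m) ℝ) (r M : ℕ) (δ : ℝ) : ℝ :=
  nuisanceRadius a₀ Lam22 δ * √(effDim a₀ r δ / M)

/-- All the bounds on one realization `(β, X, x)`, for labels generated by `w = U β`: concept
estimation, leakage, the two forms of the prediction error bound, and stability under
perturbations orthogonal to the concept subspace. Here `L` is the effective dimension, and `η` and
`q` are the coefficients that depend on the covariance regime. -/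
structure ErrorBounds {d r m M : ℕ} (U : Matrix (Fin d) (Fin r) ℝ) (V : Matrix (Fin d) (Fin m) ℝ)
    (lam Kβ KΔ L η q : ℝ) (beta : Vec r) (X : Fin M → Vec d) (x : Vec d) : Prop where
  concept :
    ‖conceptRidge U lam X (labels (act U beta) X) - beta‖ ≤ Kβ * (√L / M)
  leak :
    |leakage U V lam beta X x| ≤ KΔ * (‖act Vᵀ x‖ + q * ‖act Uᵀ x‖) * η
  split :
    |predictor lam X (labels (act U beta) X) x - ⟪act U beta, x⟫|
      ≤ ‖act Uᵀ x‖ * ‖conceptRidge U lam X (labels (act U beta) X) - beta‖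
        + |leakage U V lam beta X x|
  prediction :
    |predictor lam X (labels (act U beta) X) x - ⟪act U beta, x⟫|
      ≤ Kβ * ‖act Uᵀ x‖ * (√L / M) + KΔ * (‖act Vᵀ x‖ + q * ‖act Uᵀ x‖) * η
  stable : ∀ v ∈ (colSpan U)ᗮ,
    |predictor lam X (labels (act U beta) X) (x + v) - predictor lam X (labels (act U beta) X) x|
      ≤ KΔ * η * ‖v‖

/-- `P` holds with probability at least `1 - δ` under `μ`. -/
def HoldsWithProb {Ω : Type*} [MeasurableSpace Ω] (μ : Measure Ω) (δ : ℝ) (P : Ω → Prop) : Prop :=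
  ∃ E : Set Ω, MeasurableSet E ∧ ENNReal.ofReal (1 - δ) ≤ μ E ∧ ∀ ω ∈ E, P ω

end ConceptICL

end

namespace ConceptICL

noncomputable section

/-! ### Matrices acting on Euclidean vectors -/

section Act

variable {l m n : ℕ}

/-! Write λ = c/M and G = ZᵀZ + cI, and let T be the design with rows Vᵀxᵢ. The concept error is
exact: β − β̂ = c G⁻¹β (`sub_conceptRidge`). It has size c‖β‖/s² as soon as Z has smallest singular
value at least s, and a Gaussian design gives s = √(κM)/5.

The leakage reduces to one object, the cross vector TᵀZG⁻¹b. With b = z = Uᵀx it is BᵀA⁻¹z. With b =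
β it arises because S₂₁(β − β̂) is λ times it, while the Schur complement satisfies H ≥ λI; the two
factors λ cancel, so ‖γ‖ ≤ ‖TᵀZG⁻¹β‖ (`norm_offCoord_le`). Hence no lower bound on Λ₂₂ is needed. In
block coordinates the predictor is ⟨β̂, z⟩ plus the leakage, and it sees directions orthogonal to U
only through γ, so every bound follows from s and the two cross vectors (`errorBounds_of_crossVec`).

To bound a cross vector, split T = ZC + T' with C = Λ₁₁⁻¹Λ₁₂. The rows of T' are Λ-orthogonal to
those of Z, hence independent of Z, with covariance at most Λ₂₂. The vector b is independent of the
demonstrations, so given b and Z the vector T'ᵀ(ZG⁻¹b) is Gaussian with covariance at most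
‖ZG⁻¹b‖²Λ₂₂. Its norm is at most 2R_⊥‖ZG⁻¹b‖ ≤ 2R_⊥‖b‖/s outside an event of probability δ/4
(`hatVec_tail`). The remaining part CᵀZᵀZG⁻¹b is at most (ρ/κ)‖b‖, because ZᵀZG⁻¹ is a contraction
(`norm_crossVec_le`).

The probabilistic inputs are a Chernoff bound for weighted chi-squares, which yields the norm tail,
and a sphere net, which yields s (`gaussian_norm_tail`, `gaussian_design_tail`). -/

@[simp] lemma act_add_right (A : Matrix (Fin m) (Fin n) ℝ) (v w : Vec n) :
    act A (v + w) = act A v + act A w := by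
  simp [act, Matrix.mulVec_add]

@[simp] lemma act_sub_right (A : Matrix (Fin m) (Fin n) ℝ) (v w : Vec n) :
    act A (v - w) = act A v - act A w := by
  simp [act, Matrix.mulVec_sub]

@[simp] lemma act_smul_right (A : Matrix (Fin m) (Fin n) ℝ) (c : ℝ) (v : Vec n) :
    act A (c • v) = c • act A v := by
  simp [act, Matrix.mulVec_smul]

lemma act_add_left (A B : Matrix (Fin m) (Fin n) ℝ) (v : Vec n) :
    act (A + B) v = act A v + act B v := by
  simp [act, Matrix.add_mulVec]

lemma act_sub_left (A B : Matrix (Fin m) (Fin n) ℝ) (v : Vec n) :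
    act (A - B) v = act A v - act B v := by
  simp [act, Matrix.sub_mulVec]

lemma act_smul_left (c : ℝ) (A : Matrix (Fin m) (Fin n) ℝ) (v : Vec n) :
    act (c • A) v = c • act A v := by
  simp [act, Matrix.smul_mulVec]

@[simp] lemma act_one (v : Vec n) : act (1 : Matrix (Fin n) (Fin n) ℝ) v = v := by
  simp [act]

@[simp] lemma act_zero_left (v : Vec n) : act (0 : Matrix (Fin m) (Fin n) ℝ) v = 0 := by
  simp [act]

lemma act_mul (A : Matrix (Fin l) (Fin m) ℝ) (B : Matrix (Fin m) (Fin n) ℝ) (v : Vec n) :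
    act (A * B) v = act A (act B v) := by
  simp [act, Matrix.mulVec_mulVec]

lemma inner_eq_dotProduct (v w : Vec n) : ⟪v, w⟫ = v.ofLp ⬝ᵥ w.ofLp := by
  simp [PiLp.inner_apply, dotProduct, mul_comm]

lemma inner_act_left (A : Matrix (Fin m) (Fin n) ℝ) (v : Vec n) (w : Vec m) :
    ⟪act A v, w⟫ = ⟪v, act Aᵀ w⟫ := by
  simp only [inner_eq_dotProduct, act]
  rw [Matrix.mulVec_transpose, dotProduct_comm (A *ᵥ _), Matrix.dotProduct_mulVec,
    dotProduct_comm]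

lemma inner_act_right (A : Matrix (Fin m) (Fin n) ℝ) (v : Vec n) (w : Vec m) :
    ⟪w, act A v⟫ = ⟪act Aᵀ w, v⟫ := by
  rw [inner_act_left, Matrix.transpose_transpose]

lemma norm_act_le (A : Matrix (Fin m) (Fin n) ℝ) (v : Vec n) : ‖act A v‖ ≤ ‖A‖ * ‖v‖ := by
  rw [Matrix.l2_opNorm_def]
  exact ContinuousLinearMap.le_opNorm
    (LinearMap.toContinuousLinearMap (Matrix.toEuclideanLin A)) v

lemma continuous_act (A : Matrix (Fin m) (Fin n) ℝ) : Continuous (act A) :=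
  (LinearMap.toContinuousLinearMap (Matrix.toEuclideanLin A)).continuous

lemma act_inv_act {A : Matrix (Fin n) (Fin n) ℝ} (hA : IsUnit A.det) (v : Vec n) :
    act A⁻¹ (act A v) = v := by
  rw [← act_mul, Matrix.nonsing_inv_mul _ hA, act_one]

lemma act_act_inv {A : Matrix (Fin n) (Fin n) ℝ} (hA : IsUnit A.det) (v : Vec n) :
    act A (act A⁻¹ v) = v := by
  rw [← act_mul, Matrix.mul_nonsing_inv _ hA, act_one]

lemma act_injective_iff_isUnit_det {A : Matrix (Fin n) (Fin n) ℝ} :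
    (∀ v, act A v = 0 → v = 0) ↔ IsUnit A.det := by
  refine ⟨fun h => ?_, fun h v hv => by rw [← act_inv_act h v, hv]; simp [act]⟩
  rw [← Matrix.isUnit_iff_isUnit_det, ← Matrix.mulVec_injective_iff_isUnit]
  intro v w hvw
  have h0 := h (WithLp.toLp 2 (v - w)) (by simp_all [act, Matrix.mulVec_sub])
  have h1 := congrArg WithLp.ofLp h0
  simpa [sub_eq_zero] using h1

/-- A matrix whose quadratic form is bounded below by a positive multiple of the squared norm is
invertible. -/
lemma isUnit_det_of_le_inner {A : Matrix (Fin n) (Fin n) ℝ} {c : ℝ} (hc : 0 < c)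
    (h : ∀ v, c * ‖v‖ ^ 2 ≤ ⟪v, act A v⟫) : IsUnit A.det := by
  refine act_injective_iff_isUnit_det.1 fun v hv => ?_
  have h1 := h v
  rw [hv, inner_zero_right] at h1
  have h2 : ‖v‖ ^ 2 ≤ 0 := by nlinarith [sq_nonneg ‖v‖]
  simpa using le_antisymm h2 (sq_nonneg _)

lemma inner_act_gram (Z : Matrix (Fin m) (Fin n) ℝ) (v : Vec n) :
    ⟪v, act (Zᵀ * Z) v⟫ = ‖act Z v‖ ^ 2 := by
  rw [act_mul, inner_act_right, Matrix.transpose_transpose, real_inner_self_eq_norm_sq]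

lemma inner_act_gram_add (Z : Matrix (Fin m) (Fin n) ℝ) (c : ℝ) (v : Vec n) :
    ⟪v, act (Zᵀ * Z + c • (1 : Matrix (Fin n) (Fin n) ℝ)) v⟫ = ‖act Z v‖ ^ 2 + c * ‖v‖ ^ 2 := by
  rw [act_add_left, act_smul_left, act_one, inner_add_right, inner_act_gram, inner_smul_right,
    real_inner_self_eq_norm_sq]

lemma isUnit_det_gram_add (Z : Matrix (Fin m) (Fin n) ℝ) {c : ℝ} (hc : 0 < c) :
    IsUnit (Zᵀ * Z + c • (1 : Matrix (Fin n) (Fin n) ℝ)).det :=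
  isUnit_det_of_le_inner hc fun v => by
    rw [inner_act_gram_add]
    nlinarith [sq_nonneg ‖act Z v‖]

end Act

/-! ### The regularized normal equations -/

section Normal

variable {r m M : ℕ}

/-- The regularized Gram matrix `ZᵀZ + c I`. -/
def gramReg (Z : Matrix (Fin M) (Fin r) ℝ) (c : ℝ) : Matrix (Fin r) (Fin r) ℝ :=
  Zᵀ * Z + c • (1 : Matrix (Fin r) (Fin r) ℝ)

lemma isUnit_det_gramReg (Z : Matrix (Fin M) (Fin r) ℝ) {c : ℝ} (hc : 0 < c) :
    IsUnit (gramReg Z c).det := isUnit_det_gram_add Z hc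

lemma transpose_gramReg_inv (Z : Matrix (Fin M) (Fin r) ℝ) (c : ℝ) :
    ((gramReg Z c)⁻¹)ᵀ = (gramReg Z c)⁻¹ := by
  rw [Matrix.transpose_nonsing_inv]
  simp [gramReg, Matrix.transpose_mul]

/-- Energy identity for the solution `a = (ZᵀZ + c)⁻¹ b`. -/
lemma gramReg_energy (Z : Matrix (Fin M) (Fin r) ℝ) {c : ℝ} (hc : 0 < c) (b : Vec r) :
    ‖act Z (act (gramReg Z c)⁻¹ b)‖ ^ 2 + c * ‖act (gramReg Z c)⁻¹ b‖ ^ 2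
      = ⟪act (gramReg Z c)⁻¹ b, b⟫ := by
  rw [← inner_act_gram_add]
  congr 1
  exact act_act_inv (isUnit_det_gramReg Z hc) b

lemma norm_gramReg_inv_le (Z : Matrix (Fin M) (Fin r) ℝ) {c s : ℝ} (hc : 0 < c) (hs : 0 < s)
    (hZ : ∀ v, s * ‖v‖ ≤ ‖act Z v‖) (b : Vec r) :
    ‖act (gramReg Z c)⁻¹ b‖ ≤ ‖b‖ / s ^ 2 := by
  have h1 := gramReg_energy Z hc b
  have h2 := real_inner_le_norm (act (gramReg Z c)⁻¹ b) b
  have h3 := hZ (act (gramReg Z c)⁻¹ b)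
  set a := act (gramReg Z c)⁻¹ b
  rw [le_div_iff₀ (by positivity)]
  rcases (norm_nonneg a).eq_or_lt with h0 | h0
  · rw [← h0]; simp
  · have h4 : (s * ‖a‖) ^ 2 ≤ ‖act Z a‖ ^ 2 := by gcongr
    have h5 : ‖a‖ * (‖a‖ * s ^ 2) ≤ ‖a‖ * ‖b‖ := by nlinarith [sq_nonneg ‖a‖]
    exact le_of_mul_le_mul_left h5 h0

/-- The energy identity gives ‖Za‖² ≤ ‖a‖‖b‖ ≤ ‖b‖²/s². The order 1/s is obtained with no upper
bound on the singular values of Z. -/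
lemma norm_act_gramReg_inv_le (Z : Matrix (Fin M) (Fin r) ℝ) {c s : ℝ} (hc : 0 < c) (hs : 0 < s)
    (hZ : ∀ v, s * ‖v‖ ≤ ‖act Z v‖) (b : Vec r) :
    ‖act Z (act (gramReg Z c)⁻¹ b)‖ ≤ ‖b‖ / s := by
  have h1 := gramReg_energy Z hc b
  have h2 := real_inner_le_norm (act (gramReg Z c)⁻¹ b) b
  have h3 := norm_gramReg_inv_le Z hc hs hZ b
  set a := act (gramReg Z c)⁻¹ b
  refine abs_le_of_sq_le_sq' ?_ (by positivity) |>.2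
  have h4 : ‖a‖ * ‖b‖ ≤ ‖b‖ / s ^ 2 * ‖b‖ := by gcongr
  have h5 : (‖b‖ / s) ^ 2 = ‖b‖ / s ^ 2 * ‖b‖ := by field_simp
  nlinarith [mul_nonneg hc.le (sq_nonneg ‖a‖)]

/-- ZᵀZ(ZᵀZ + c)⁻¹ is a contraction whatever the conditioning of Z: it sends b to b − ca, and the
energy identity shows that subtracting ca does not increase the norm. -/
lemma norm_gram_gramReg_inv_le (Z : Matrix (Fin M) (Fin r) ℝ) {c : ℝ} (hc : 0 < c) (b : Vec r) :
    ‖act Zᵀ (act Z (act (gramReg Z c)⁻¹ b))‖ ≤ ‖b‖ := by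
  have h1 := gramReg_energy Z hc b
  have h2 := act_act_inv (isUnit_det_gramReg Z hc) b
  set a := act (gramReg Z c)⁻¹ b
  rw [gramReg, act_add_left, act_smul_left, act_one, act_mul] at h2
  have h3 : act Zᵀ (act Z a) = b - c • a := by rw [← h2]; abel
  rw [h3]
  refine abs_le_of_sq_le_sq' ?_ (by positivity) |>.2
  rw [norm_sub_sq_real, inner_smul_right, norm_smul, Real.norm_of_nonneg hc.le,
    real_inner_comm, ← h1]
  nlinarith [mul_nonneg hc.le (sq_nonneg ‖act Z a‖), sq_nonneg (c * ‖a‖)]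

/-- `Z (ZᵀZ + c)⁻¹ Zᵀ` is bounded above by the identity. -/
lemma inner_hat_le (Z : Matrix (Fin M) (Fin r) ℝ) {c : ℝ} (hc : 0 < c) (e : Vec M) :
    ⟪act Zᵀ e, act (gramReg Z c)⁻¹ (act Zᵀ e)⟫ ≤ ‖e‖ ^ 2 := by
  have h1 := gramReg_energy Z hc (act Zᵀ e)
  set a := act (gramReg Z c)⁻¹ (act Zᵀ e)
  have h2 : ⟪a, act Zᵀ e⟫ = ⟪act Z a, e⟫ := by
    rw [inner_act_right, Matrix.transpose_transpose]
  rw [real_inner_comm, h2]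
  rw [h2] at h1
  have h3 := real_inner_le_norm (act Z a) e
  nlinarith [mul_nonneg hc.le (sq_nonneg ‖a‖), sq_nonneg (‖act Z a‖ - ‖e‖)]

end Normal

/-! ### The ridge predictor in block coordinates -/

section Blocks

variable {d r m M : ℕ}

/-- The `M × d` matrix whose rows are the demonstration inputs. -/
def design (X : Fin M → Vec d) : Matrix (Fin M) (Fin d) ℝ := Matrix.of fun i => (X i).ofLp

lemma conceptDesign_eq (U : Matrix (Fin d) (Fin r) ℝ) (X : Fin M → Vec d) :
    conceptDesign U X = design X * U := by
  ext i j
  simp [conceptDesign, act, design, Matrix.mul_apply, Matrix.mulVec, dotProduct, mul_comm]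

lemma empCov_eq (X : Fin M → Vec d) :
    empCov X = (1 / (M : ℝ)) • ((design X)ᵀ * design X) := by
  ext i j
  simp [empCov, design, Matrix.mul_apply, Matrix.sum_apply, Matrix.vecMulVec_apply]

lemma labels_eq (U : Matrix (Fin d) (Fin r) ℝ) (X : Fin M → Vec d) (beta : Vec r) :
    labels (act U beta) X = (act (conceptDesign U X) beta).ofLp := by
  ext i
  rw [conceptDesign_eq, act_mul, labels, real_inner_comm, inner_eq_dotProduct]
  rfl

lemma sum_smul_eq_act (X : Fin M → Vec d) (y : Fin M → ℝ) :
    ∑ i, y i • X i = act (design X)ᵀ (WithLp.toLp 2 y) := by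
  ext j
  simp [act, design, Matrix.mulVec, dotProduct, mul_comm]

lemma transpose_mul_empCov_mul (U : Matrix (Fin d) (Fin r) ℝ) (V : Matrix (Fin d) (Fin m) ℝ)
    (X : Fin M → Vec d) :
    Uᵀ * empCov X * V = (1 / (M : ℝ)) • ((conceptDesign U X)ᵀ * conceptDesign V X) := by
  simp [empCov_eq, conceptDesign_eq, Matrix.transpose_mul, Matrix.mul_assoc]

variable (U : Matrix (Fin d) (Fin r) ℝ) (V : Matrix (Fin d) (Fin m) ℝ) (X : Fin M → Vec d)

lemma conceptRidge_eq {c : ℝ} (hM : (0 : ℝ) < M) (beta : Vec r) :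
    conceptRidge U (c / M) X (labels (act U beta) X)
      = act (gramReg (conceptDesign U X) c)⁻¹
          (act (conceptDesign U X)ᵀ (act (conceptDesign U X) beta)) := by
  rw [conceptRidge, labels_eq, mul_div_cancel₀ _ hM.ne']
  rfl

lemma sub_conceptRidge {c : ℝ} (hM : (0 : ℝ) < M) (hc : 0 < c) (beta : Vec r) :
    beta - conceptRidge U (c / M) X (labels (act U beta) X)
      = c • act (gramReg (conceptDesign U X) c)⁻¹ beta := by
  rw [conceptRidge_eq U X hM]
  have h := act_inv_act (isUnit_det_gramReg (conceptDesign U X) hc) beta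
  rw [gramReg, act_add_left, act_smul_left, act_one, act_mul, act_add_right, act_smul_right,
    ← gramReg] at h
  nth_rewrite 1 [← h]
  abel

lemma blockA_eq {c : ℝ} :
    blockA U (c / M) X = (1 / (M : ℝ)) • gramReg (conceptDesign U X) c := by
  rw [blockA, transpose_mul_empCov_mul, gramReg, smul_add, smul_smul]
  congr 2
  ring

lemma blockA_inv_eq {c : ℝ} (hM : (0 : ℝ) < M) (hc : 0 < c) :
    (blockA U (c / M) X)⁻¹ = (M : ℝ) • (gramReg (conceptDesign U X) c)⁻¹ := by
  refine Matrix.inv_eq_left_inv ?_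
  rw [blockA_eq, smul_mul_smul_comm, Matrix.nonsing_inv_mul _ (isUnit_det_gramReg _ hc),
    mul_one_div_cancel hM.ne', one_smul]

lemma blockA_inv_mul_blockB {c : ℝ} (hM : (0 : ℝ) < M) (hc : 0 < c) :
    (blockA U (c / M) X)⁻¹ * blockB U V X
      = (gramReg (conceptDesign U X) c)⁻¹ * ((conceptDesign U X)ᵀ * conceptDesign V X) := by
  rw [blockA_inv_eq U X hM hc, blockB, transpose_mul_empCov_mul, Matrix.smul_mul, Matrix.mul_smul,
    smul_smul, mul_one_div_cancel hM.ne', one_smul]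

lemma isUnit_det_blockA {c : ℝ} (hM : (0 : ℝ) < M) (hc : 0 < c) :
    IsUnit (blockA U (c / M) X).det := by
  rw [blockA_eq, Matrix.det_smul]
  exact ((isUnit_iff_ne_zero.2 (by positivity)).pow _).mul (isUnit_det_gramReg _ hc)

/-- H = λI + (1/M) Tᵀ(I − Z G⁻¹ Zᵀ)T, and the hat matrix in the middle is at most the identity by
`inner_hat_le`. -/
lemma le_inner_schurH {c : ℝ} (hM : (0 : ℝ) < M) (hc : 0 < c) (v : Vec m) :
    c / M * ‖v‖ ^ 2 ≤ ⟪v, act (schurH U V (c / M) X) v⟫ := by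
  rw [schurH, Matrix.mul_assoc (blockB U V X)ᵀ, blockA_inv_mul_blockB U V X hM hc, blockB,
    transpose_mul_empCov_mul, transpose_mul_empCov_mul, act_sub_left, act_add_left, act_smul_left,
    act_smul_left, act_one, inner_sub_right, inner_add_right, inner_smul_right, inner_smul_right,
    inner_act_gram, real_inner_self_eq_norm_sq, Matrix.transpose_smul, Matrix.smul_mul,
    act_smul_left, inner_smul_right, Matrix.transpose_mul, Matrix.transpose_transpose,
    act_mul, act_mul, act_mul, act_mul, inner_act_right, inner_act_right,
    Matrix.transpose_transpose]
  have h := inner_hat_le (conceptDesign U X) hc (act (conceptDesign V X) v)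
  have h2 := mul_le_mul_of_nonneg_left h (one_div_pos.2 hM).le
  linarith

lemma isUnit_det_schurH {c : ℝ} (hM : (0 : ℝ) < M) (hc : 0 < c) :
    IsUnit (schurH U V (c / M) X).det :=
  isUnit_det_of_le_inner (div_pos hc hM) (le_inner_schurH U V X hM hc)

lemma act_schurH_offCoord {c : ℝ} (hM : (0 : ℝ) < M) (hc : 0 < c) (beta : Vec r) :
    act (schurH U V (c / M) X) (offCoord U V (c / M) beta X)
      = act (blockB U V X)ᵀ (beta - conceptRidge U (c / M) X (labels (act U beta) X)) := by
  rw [offCoord, act_mul, act_act_inv (isUnit_det_schurH U V X hM hc)]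

/-- The dual form `Tᵀ Z (ZᵀZ + c)⁻¹ b` of `Bᵀ A⁻¹ b`. -/
def crossVec (c : ℝ) (b : Vec r) : Vec m :=
  act (conceptDesign V X)ᵀ (act (conceptDesign U X) (act (gramReg (conceptDesign U X) c)⁻¹ b))

/-- Pairing Hγ = S₂₁(β − β̂) with γ puts λ‖γ‖² on the left and λ⟨γ, TᵀZG⁻¹β⟩ on the right; the
factor λ = c/M cancels. -/
lemma norm_offCoord_le {c : ℝ} (hM : (0 : ℝ) < M) (hc : 0 < c) (beta : Vec r) :
    ‖offCoord U V (c / M) beta X‖ ≤ ‖crossVec U V X c beta‖ := by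
  have h1 := le_inner_schurH U V X hM hc (offCoord U V (c / M) beta X)
  rw [act_schurH_offCoord U V X hM hc, sub_conceptRidge U X hM hc, blockB,
    transpose_mul_empCov_mul, Matrix.transpose_smul, act_smul_left, act_smul_right,
    Matrix.transpose_mul, Matrix.transpose_transpose, act_mul, smul_smul, inner_smul_right,
    ← crossVec] at h1
  have h2 := real_inner_le_norm (offCoord U V (c / M) beta X) (crossVec U V X c beta)
  set g := offCoord U V (c / M) beta X
  have hp : 0 < c / M := div_pos hc hM
  rw [one_div_mul_eq_div] at h1
  have h3 := le_of_mul_le_mul_left h1 hp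
  rcases (norm_nonneg g).eq_or_lt with h0 | h0
  · rw [← h0]; positivity
  · exact le_of_mul_le_mul_left (by nlinarith) h0

lemma leakage_le {c : ℝ} (hM : (0 : ℝ) < M) (hc : 0 < c) (beta : Vec r) (x : Vec d) :
    |leakage U V (c / M) beta X x|
      ≤ (‖act Vᵀ x‖ + ‖crossVec U V X c (act Uᵀ x)‖) * ‖offCoord U V (c / M) beta X‖ := by
  have h : ⟪act Uᵀ x, act ((blockA U (c / M) X)⁻¹ * blockB U V X) (offCoord U V (c / M) beta X)⟫
      = ⟪crossVec U V X c (act Uᵀ x), offCoord U V (c / M) beta X⟫ := by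
    rw [blockA_inv_mul_blockB U V X hM hc, inner_act_right, Matrix.transpose_mul,
      transpose_gramReg_inv, Matrix.transpose_mul, Matrix.transpose_transpose, act_mul, act_mul,
      crossVec]
  rw [leakage, h, add_mul]
  exact (abs_sub _ _).trans (add_le_add (abs_real_inner_le_norm _ _) (abs_real_inner_le_norm _ _))

end Blocks

/-! ### The ambient predictor and the deterministic reduction to cross vectors -/

section Predictor

variable {d r M : ℕ} {U : Matrix (Fin d) (Fin r) ℝ} {V : Matrix (Fin d) (Fin (d - r)) ℝ}

lemma IsOrthonormalComplement.orthogonal' (h : IsOrthonormalComplement U V) : Vᵀ * U = 0 := by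
  have := congrArg Matrix.transpose h.orthogonal
  simpa [Matrix.transpose_mul] using this

/-- The matrix [U V] is square because r ≤ d, so its left inverse is also a right inverse. -/
lemma IsOrthonormalComplement.add_eq_one (h : IsOrthonormalComplement U V) :
    U * Uᵀ + V * Vᵀ = 1 := by
  rw [← Matrix.fromCols_mul_fromRows, Matrix.mul_eq_one_comm_of_card_eq,
    Matrix.fromRows_mul_fromCols, h.orthonormal, h.orthonormal_compl, h.orthogonal, h.orthogonal',
    Matrix.fromBlocks_one]
  simp [h.le]

lemma IsOrthonormalComplement.act_add (h : IsOrthonormalComplement U V) (x : Vec d) :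
    act U (act Uᵀ x) + act V (act Vᵀ x) = x := by
  rw [← act_mul, ← act_mul, ← act_add_left, h.add_eq_one, act_one]

lemma IsOrthonormalComplement.ext (h : IsOrthonormalComplement U V) {x y : Vec d}
    (h1 : act Uᵀ x = act Uᵀ y) (h2 : act Vᵀ x = act Vᵀ y) : x = y := by
  rw [← h.act_add x, ← h.act_add y, h1, h2]

lemma IsOrthonormalComplement.norm_act_le (h : IsOrthonormalComplement U V) (x : Vec d) :
    ‖act Vᵀ x‖ ≤ ‖x‖ := by
  have h1 : ‖act Vᵀ x‖ ^ 2 = ⟪act V (act Vᵀ x), x⟫ := by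
    rw [inner_act_left, real_inner_self_eq_norm_sq]
  have h2 : ‖act V (act Vᵀ x)‖ ^ 2 = ‖act Vᵀ x‖ ^ 2 := by
    rw [← inner_act_gram, h.orthonormal_compl, act_one, real_inner_self_eq_norm_sq]
  have h3 := real_inner_le_norm (act V (act Vᵀ x)) x
  rw [← h1, (sq_eq_sq₀ (norm_nonneg _) (norm_nonneg _)).1 h2] at h3
  rcases (norm_nonneg (act Vᵀ x)).eq_or_lt with h0 | h0
  · rw [← h0]; positivity
  · exact le_of_mul_le_mul_left (by nlinarith) h0

lemma act_transpose_of_mem_orthogonal {v : Vec d} (hv : v ∈ (colSpan U)ᗮ) : act Uᵀ v = 0 := by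
  ext j
  have h := (Submodule.mem_orthogonal _ _).1 hv _ (Submodule.subset_span ⟨j, rfl⟩)
  rw [inner_eq_dotProduct] at h
  simpa [act, Matrix.mulVec, dotProduct] using h

/-- Block form of the ambient ridge estimator. -/
lemma ridge_eq (h : IsOrthonormalComplement U V) {c : ℝ} (hM : (0 : ℝ) < M) (hc : 0 < c)
    (X : Fin M → Vec d) (beta : Vec r) :
    ridge (c / M) X (labels (act U beta) X)
      = act U (conceptRidge U (c / M) X (labels (act U beta) X)
          - act ((blockA U (c / M) X)⁻¹ * blockB U V X) (offCoord U V (c / M) beta X))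
        + act V (offCoord U V (c / M) beta X) := by
  have hS : IsUnit (empCov X + (c / M) • (1 : Matrix (Fin d) (Fin d) ℝ)).det := by
    refine isUnit_det_of_le_inner (div_pos hc hM) fun v => ?_
    rw [empCov_eq, act_add_left, act_smul_left, act_smul_left, act_one, inner_add_right,
      inner_smul_right, inner_smul_right, inner_act_gram, real_inner_self_eq_norm_sq]
    have : 0 ≤ 1 / (M : ℝ) * ‖act (design X) v‖ ^ 2 := by positivity
    linarith
  have hA := isUnit_det_blockA U X hM hc
  have hH := act_schurH_offCoord U V X hM hc beta
  have hb : conceptRidge U (c / M) X (labels (act U beta) X)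
      = act (blockA U (c / M) X)⁻¹ (act (Uᵀ * empCov X * U) beta) := by
    rw [conceptRidge_eq U X hM, blockA_inv_eq U X hM hc, transpose_mul_empCov_mul, act_smul_left,
      act_smul_left, act_smul_right, smul_smul, mul_one_div_cancel hM.ne', one_smul, act_mul]
  set g := offCoord U V (c / M) beta X
  set b := conceptRidge U (c / M) X (labels (act U beta) X)
  have hw : (1 / (M : ℝ)) • ∑ i, labels (act U beta) X i • X i = act (empCov X) (act U beta) := by
    rw [sum_smul_eq_act, labels_eq, empCov_eq, act_smul_left, conceptDesign_eq, act_mul, act_mul]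
  rw [ridge, hw]
  have hAa : act (blockA U (c / M) X) (b - act ((blockA U (c / M) X)⁻¹ * blockB U V X) g)
      = act (Uᵀ * empCov X * U) beta - act (blockB U V X) g := by
    rw [act_sub_right, hb, act_mul _ (blockB U V X), act_act_inv hA, act_act_inv hA]
  set a := b - act ((blockA U (c / M) X)⁻¹ * blockB U V X) g with ha
  -- The claimed solution is checked against the normal equations rather than derived by block
  -- inversion. The Uᵀ component is `hAa`, and the Vᵀ component becomes the Schur equation `hH` once
  -- a is expanded.
  suffices hE : act (empCov X) (act U beta)
      = act (empCov X + (c / M) • (1 : Matrix (Fin d) (Fin d) ℝ)) (act U a + act V g) by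
    rw [hE, act_inv_act hS]
  have hUU : ∀ v, act Uᵀ (act U v) = v := fun v => by rw [← act_mul, h.orthonormal, act_one]
  have hVV : ∀ v, act Vᵀ (act V v) = v := fun v => by rw [← act_mul, h.orthonormal_compl, act_one]
  have hUV : ∀ v, act Uᵀ (act V v) = 0 := fun v => by
    rw [← act_mul, h.orthogonal, act_zero_left]
  have hVU : ∀ v, act Vᵀ (act U v) = 0 := fun v => by
    rw [← act_mul, h.orthogonal', act_zero_left]
  have hST : (empCov X)ᵀ = empCov X := by simp [empCov_eq, Matrix.transpose_mul]
  have hBT : (blockB U V X)ᵀ = Vᵀ * empCov X * U := by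
    simp [blockB, Matrix.transpose_mul, hST, Matrix.mul_assoc]
  refine h.ext ?_ ?_
  · simp only [blockA, blockB, act_add_left, act_smul_left, act_one, act_mul] at hAa
    simp only [act_add_left, act_smul_left, act_one, act_add_right, act_smul_right, hUU, hUV,
      smul_zero, add_zero]
    rw [← sub_eq_iff_eq_add'.2 (sub_eq_iff_eq_add.1 hAa.symm)]
    abel
  · rw [schurH, Matrix.mul_assoc (blockB U V X)ᵀ, act_sub_left, act_mul (blockB U V X)ᵀ, hBT] at hH
    simp only [act_add_left, act_smul_left, act_one, act_mul, act_sub_right] at hH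
    rw [ha]
    simp only [act_add_left, act_smul_left, act_one, act_add_right, act_smul_right, hVV, hVU,
      smul_zero, act_sub_right, act_mul]
    rw [sub_eq_iff_eq_add] at hH
    have h2 := congrArg (fun v => v + act Vᵀ (act (empCov X) (act U b))) hH
    simp only [blockB, act_mul] at h2 ⊢
    rw [eq_comm, ← sub_eq_zero] at h2 ⊢
    rw [← neg_eq_zero, ← h2]
    abel

lemma predictor_eq (h : IsOrthonormalComplement U V) {c : ℝ} (hM : (0 : ℝ) < M) (hc : 0 < c)
    (X : Fin M → Vec d) (beta : Vec r) (x : Vec d) :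
    predictor (c / M) X (labels (act U beta) X) x
      = ⟪conceptRidge U (c / M) X (labels (act U beta) X), act Uᵀ x⟫
        + leakage U V (c / M) beta X x := by
  rw [predictor, ridge_eq h hM hc, inner_add_left, inner_act_left, inner_act_left,
    inner_sub_left, leakage, real_inner_comm (act Vᵀ x),
    real_inner_comm (act Uᵀ x) (act (_ * _) _)]
  ring

/-- The bounds of `ErrorBounds` follow from a lower bound on the concept design, a bound on the task
coordinate, and bounds on the two cross vectors. -/
lemma errorBounds_of_crossVec (h : IsOrthonormalComplement U V) {c s b K L η q : ℝ}
    (hM : (0 : ℝ) < M) (hc : 0 < c) (hs : 0 < s) (hK : 1 ≤ K) (hη : 0 ≤ η)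
    {beta : Vec r} {X : Fin M → Vec d} {x : Vec d}
    (hZ : ∀ v, s * ‖v‖ ≤ ‖act (conceptDesign U X) v‖)
    (hβ : c * (‖beta‖ / s ^ 2) ≤ b * (√L / M))
    (h1 : ‖crossVec U V X c beta‖ ≤ K * η)
    (h2 : ‖crossVec U V X c (act Uᵀ x)‖ ≤ K * (q * ‖act Uᵀ x‖)) :
    ErrorBounds U V (c / M) b (K ^ 2) L η q beta X x := by
  have hg : ‖offCoord U V (c / M) beta X‖ ≤ K * η := (norm_offCoord_le U V X hM hc beta).trans h1
  have hconcept : ‖conceptRidge U (c / M) X (labels (act U beta) X) - beta‖ ≤ b * (√L / M) := by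
    rw [norm_sub_rev, sub_conceptRidge U X hM hc, norm_smul, Real.norm_of_nonneg hc.le]
    exact (mul_le_mul_of_nonneg_left (norm_gramReg_inv_le _ hc hs hZ beta) hc.le).trans hβ
  have hleak : |leakage U V (c / M) beta X x|
      ≤ K ^ 2 * (‖act Vᵀ x‖ + q * ‖act Uᵀ x‖) * η := by
    refine (leakage_le U V X hM hc beta x).trans ?_
    -- One factor K comes from γ and one from the cross vector of z; 1 ≤ K lets the ‖t‖ term share
    -- the second, whence K².
    calc _ ≤ (K * ‖act Vᵀ x‖ + K * (q * ‖act Uᵀ x‖)) * (K * η) := by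
          have := (norm_nonneg _).trans h2
          gcongr
          exact le_mul_of_one_le_left (norm_nonneg (act Vᵀ x)) hK
      _ = _ := by ring
  have hsplit : |predictor (c / M) X (labels (act U beta) X) x - ⟪act U beta, x⟫|
      ≤ ‖act Uᵀ x‖ * ‖conceptRidge U (c / M) X (labels (act U beta) X) - beta‖
        + |leakage U V (c / M) beta X x| := by
    rw [predictor_eq h hM hc, inner_act_left, add_sub_right_comm, ← inner_sub_left, mul_comm]
    exact (abs_add_le _ _).trans (by gcongr; exact abs_real_inner_le_norm _ _)
  refine ⟨hconcept, hleak, hsplit, hsplit.trans ?_, fun v hv => ?_⟩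
  · calc _ ≤ ‖act Uᵀ x‖ * (b * (√L / M)) + K ^ 2 * (‖act Vᵀ x‖ + q * ‖act Uᵀ x‖) * η := by gcongr
      _ = _ := by ring
  · rw [predictor, predictor, ← inner_sub_right, add_sub_cancel_left, ridge_eq h hM hc,
      inner_add_left, inner_act_left, inner_act_left, act_transpose_of_mem_orthogonal hv,
      inner_zero_right, zero_add]
    refine (abs_real_inner_le_norm _ _).trans ?_
    calc _ ≤ K * η * ‖v‖ := by gcongr; exact h.norm_act_le v
      _ ≤ K ^ 2 * η * ‖v‖ := by gcongr; nlinarith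

end Predictor

/-! ### Weighted chi-square tails -/

section ChiSquare

lemma integral_exp_mul_sq_gaussianReal {t : ℝ} (ht : t < 1 / 2) :
    ∫ x, Real.exp (t * x ^ 2) ∂(gaussianReal 0 1) = (√(1 - 2 * t))⁻¹ := by
  rw [integral_gaussianReal_eq_integral_smul one_ne_zero]
  have h : ∀ x : ℝ, gaussianPDFReal 0 1 x • Real.exp (t * x ^ 2)
      = (√(2 * Real.pi))⁻¹ * Real.exp (-(1 / 2 - t) * x ^ 2) := fun x => by
    rw [gaussianPDFReal, smul_eq_mul, mul_assoc, ← Real.exp_add]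
    simp only [NNReal.coe_one, mul_one, sub_zero]
    congr 2
    ring
  simp_rw [h]
  rw [integral_const_mul, integral_gaussian, ← Real.sqrt_inv, ← Real.sqrt_inv,
    ← Real.sqrt_mul (by positivity)]
  congr 1
  have : (1 - 2 * t) ≠ 0 := by linarith
  have : (1 / 2 - t) ≠ 0 := by linarith
  field_simp

/-- Chernoff bound for a linear combination of independent squared standard Gaussians. -/
lemma measureReal_le_sum_mul_sq {ι : Type*} [Fintype ι] {t : ι → ℝ} (ht : ∀ j, t j < 1 / 2)
    (a : ℝ) :
    (Measure.pi fun _ : ι => gaussianReal 0 1).real {x | a ≤ ∑ j, t j * x j ^ 2}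
      ≤ Real.exp (-a) * ∏ j, (√(1 - 2 * t j))⁻¹ := by
  have h1 : ∫ x : ι → ℝ, Real.exp (∑ j, t j * x j ^ 2) ∂(Measure.pi fun _ : ι => gaussianReal 0 1)
      = ∏ j, (√(1 - 2 * t j))⁻¹ := by
    simp_rw [Real.exp_sum]
    rw [integral_fintype_prod_eq_prod (f := fun j x => Real.exp (t j * x ^ 2))]
    exact Finset.prod_congr rfl fun j _ => integral_exp_mul_sq_gaussianReal (ht j)
  have h2 : 0 < ∏ j, (√(1 - 2 * t j))⁻¹ := Finset.prod_pos fun j _ => by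
    have := ht j
    have : 0 < 1 - 2 * t j := by linarith
    positivity
  have h3 := measure_ge_le_exp_mul_mgf (μ := Measure.pi fun _ : ι => gaussianReal 0 1)
    (X := fun x => ∑ j, t j * x j ^ 2) (t := 1) a zero_le_one
    (by simp_rw [one_mul]; exact .of_integral_ne_zero (by rw [h1]; exact h2.ne'))
  simpa only [mgf, one_mul, h1, neg_one_mul] using h3

lemma inv_sqrt_one_sub_le_exp {u : ℝ} (h0 : 0 ≤ u) (h1 : u ≤ 1 / 2) :
    (√(1 - u))⁻¹ ≤ Real.exp u := by
  have h2 : 0 < 1 - u := by linarith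
  rw [inv_le_comm₀ (by positivity) (by positivity), ← Real.exp_neg]
  refine Real.le_sqrt_of_sq_le ?_
  rw [← Real.exp_nat_mul]
  -- (1 + 2u)(1 − u) = 1 + u(1 − 2u) ≥ 1; this is where u ≤ 1/2 enters.
  have h3 : Real.exp (2 * u) * (1 - u) ≥ 1 := by nlinarith [Real.add_one_le_exp (2 * u)]
  have h4 : Real.exp (((2 : ℕ) : ℝ) * -u) * Real.exp (2 * u) = 1 := by
    rw [← Real.exp_add]; simp
  nlinarith [Real.exp_pos (((2 : ℕ) : ℝ) * -u)]

end ChiSquare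

/-! ### Linear images of Gaussian vectors -/

section Images

variable {m n M : ℕ}

lemma inner_act_nonneg {S : Matrix (Fin n) (Fin n) ℝ} (hS : S.PosSemidef) (v : Vec n) :
    0 ≤ ⟪v, act S v⟫ := by
  have h := hS.dotProduct_mulVec_nonneg v.ofLp
  rwa [star_trivial, ← show ⟪v, act S v⟫ = v.ofLp ⬝ᵥ S *ᵥ v.ofLp from inner_eq_dotProduct _ _] at h

lemma posSemidef_mul_mul_transpose {S : Matrix (Fin n) (Fin n) ℝ} (hS : S.PosSemidef)
    (A : Matrix (Fin m) (Fin n) ℝ) : (A * S * Aᵀ).PosSemidef := by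
  simpa using hS.mul_mul_conjTranspose_same A

lemma charFun_gaussian {S : Matrix (Fin n) (Fin n) ℝ} (hS : S.PosSemidef) (v : Vec n) :
    charFun (multivariateGaussian 0 S) v = Complex.exp (-(⟪v, act S v⟫ : ℝ) / 2) := by
  have h : ⟪v, act S v⟫ = v.ofLp ⬝ᵥ S *ᵥ v.ofLp := inner_eq_dotProduct _ _
  rw [charFun_multivariateGaussian hS, h]
  simp [neg_div]

lemma map_act_gaussian {S : Matrix (Fin n) (Fin n) ℝ} (hS : S.PosSemidef)
    (A : Matrix (Fin m) (Fin n) ℝ) :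
    (multivariateGaussian 0 S).map (act A) = multivariateGaussian 0 (A * S * Aᵀ) := by
  have : IsFiniteMeasure ((multivariateGaussian 0 S).map (act A)) := inferInstance
  refine Measure.ext_of_charFun ?_
  ext v
  rw [charFun_gaussian (posSemidef_mul_mul_transpose hS A), charFun_apply,
    integral_map (continuous_act A).aemeasurable (Continuous.aestronglyMeasurable (by fun_prop))]
  simp_rw [inner_act_left]
  rw [← charFun_apply, charFun_gaussian hS, Matrix.mul_assoc, act_mul, act_mul, inner_act_right A]

/-- A weighted sum of independent centered Gaussian vectors is Gaussian. -/
lemma map_sum_smul_gaussian {S : Matrix (Fin n) (Fin n) ℝ} (hS : S.PosSemidef) (u : Vec M) :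
    (Measure.pi fun _ : Fin M => multivariateGaussian 0 S).map (fun Y => ∑ i, u i • Y i)
      = multivariateGaussian 0 (‖u‖ ^ 2 • S) := by
  have hm : Measurable fun Y : Fin M → Vec n => ∑ i, u i • Y i := by fun_prop
  have : IsProbabilityMeasure ((Measure.pi fun _ : Fin M => multivariateGaussian 0 S).map
      (fun Y => ∑ i, u i • Y i)) := Measure.isProbabilityMeasure_map hm.aemeasurable
  refine Measure.ext_of_charFun ?_
  ext v
  rw [charFun_gaussian (hS.smul (sq_nonneg _)), charFun_apply,
    integral_map hm.aemeasurable (Continuous.aestronglyMeasurable (by fun_prop))]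
  simp_rw [sum_inner, Complex.ofReal_sum, Finset.sum_mul, Complex.exp_sum]
  rw [integral_fintype_prod_eq_prod
    (f := fun i (x : Vec n) => Complex.exp (((⟪u i • x, v⟫ : ℝ) : ℂ) * Complex.I))]
  simp_rw [real_inner_smul_left, ← real_inner_smul_right, ← charFun_apply, charFun_gaussian hS,
    ← Complex.exp_sum, act_smul_right, act_smul_left, real_inner_smul_left, real_inner_smul_right]
  congr 1
  rw [EuclideanSpace.real_norm_sq_eq, Finset.sum_mul, ← Finset.sum_div, Finset.sum_neg_distrib]
  push_cast
  congr 2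
  exact Finset.sum_congr rfl fun i _ => by ring

end Images

/-! ### Norms of Gaussian vectors -/

section Norm

variable {n M : ℕ}

/-- A positive semidefinite matrix is `A Aᵀ` with `AᵀA` diagonal. -/
lemma exists_mul_transpose_eq {S : Matrix (Fin n) (Fin n) ℝ} (hS : S.PosSemidef) :
    ∃ (A : Matrix (Fin n) (Fin n) ℝ) (e : Fin n → ℝ), S = A * Aᵀ ∧ Aᵀ * A = Matrix.diagonal e ∧
      (∀ j, 0 ≤ e j) ∧ S.trace = ∑ j, e j ∧
      ∀ b, (∀ v, ⟪v, act S v⟫ ≤ b * ‖v‖ ^ 2) → ∀ j, e j ≤ b := by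
  have hH := hS.isHermitian
  set Q : Matrix (Fin n) (Fin n) ℝ := (hH.eigenvectorUnitary : Matrix (Fin n) (Fin n) ℝ)
  have hQ : Qᵀ * Q = 1 := by
    have := Unitary.coe_star_mul_self hH.eigenvectorUnitary
    simpa [Matrix.star_eq_conjTranspose] using this
  have hspec : S = Q * Matrix.diagonal hH.eigenvalues * Qᵀ := by
    have h := hH.spectral_theorem
    rw [Unitary.conjStarAlgAut_apply] at h
    simpa [Matrix.star_eq_conjTranspose] using! h
  have hD : Matrix.diagonal (fun j => √(hH.eigenvalues j))
      * Matrix.diagonal (fun j => √(hH.eigenvalues j)) = Matrix.diagonal hH.eigenvalues := by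
    rw [Matrix.diagonal_mul_diagonal]
    congr 1
    ext j
    exact Real.mul_self_sqrt (hS.eigenvalues_nonneg j)
  refine ⟨Q * Matrix.diagonal (fun j => √(hH.eigenvalues j)), hH.eigenvalues, ?_, ?_,
    hS.eigenvalues_nonneg, by simpa using hH.trace_eq_sum_eigenvalues, fun b hb j => ?_⟩
  · rw [Matrix.transpose_mul, Matrix.diagonal_transpose, Matrix.mul_assoc,
      ← Matrix.mul_assoc (Matrix.diagonal _) (Matrix.diagonal _), hD, ← Matrix.mul_assoc, ← hspec]
  · rw [Matrix.transpose_mul, Matrix.diagonal_transpose, Matrix.mul_assoc, ← Matrix.mul_assoc Qᵀ,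
      hQ, Matrix.one_mul, hD]
  -- Each eigenvalue is the quadratic form evaluated at its unit eigenvector.
  · have h1 := hb (hH.eigenvectorBasis j)
    rw [hH.eigenvectorBasis.orthonormal.1 j, one_pow, mul_one] at h1
    have h2 := hH.eigenvalues_eq j
    rw [star_trivial] at h2
    rw [h2]
    rwa [inner_eq_dotProduct] at h1

/-- Tail bound for the norm of a centered Gaussian vector. -/
lemma gaussian_norm_tail {S : Matrix (Fin n) (Fin n) ℝ} (hS : S.PosSemidef) {τ b a : ℝ}
    (hτ : S.trace ≤ τ) (hb0 : 0 ≤ b) (hb : ∀ v, ⟪v, act S v⟫ ≤ b * ‖v‖ ^ 2) (ha : 0 ≤ a) :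
    (multivariateGaussian 0 S).real {g | 2 * (√τ + √(b * a)) < ‖g‖} ≤ Real.exp (-a) := by
  obtain ⟨A, e, hA, hAe, he0, htr, heb⟩ := exists_mul_transpose_eq hS
  have hlaw : multivariateGaussian 0 S
      = (Measure.pi fun _ : Fin n => gaussianReal 0 1).map (fun x => act A (WithLp.toLp 2 x)) := by
    have h1 := map_act_gaussian (Matrix.PosSemidef.one (n := Fin n) (R := ℝ)) A
    rw [Matrix.mul_one, ← hA, multivariateGaussian_zero_one, ← map_pi_eq_stdGaussian,
      Measure.map_map (continuous_act A).measurable (by fun_prop)] at h1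
    exact h1.symm
  have hmeas : Measurable fun x : Fin n → ℝ => act A (WithLp.toLp 2 x) :=
    (continuous_act A).measurable.comp (by fun_prop)
  have hnorm : ∀ x : Fin n → ℝ, ‖act A (WithLp.toLp 2 x)‖ ^ 2 = ∑ j, e j * x j ^ 2 := fun x => by
    rw [← inner_act_gram, hAe, inner_eq_dotProduct]
    simp only [act, Matrix.mulVec_diagonal, dotProduct]
    exact Finset.sum_congr rfl fun j _ => by ring
  have hτ0 : 0 ≤ τ := (htr ▸ Finset.sum_nonneg fun j _ => he0 j : 0 ≤ S.trace).trans hτ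
  rw [hlaw, map_measureReal_apply hmeas (measurableSet_lt (by fun_prop) (by fun_prop))]
  have hsub : ∀ x : Fin n → ℝ, 2 * (√τ + √(b * a)) < ‖act A (WithLp.toLp 2 x)‖ →
      2 * τ + 4 * (b * a) < ∑ j, e j * x j ^ 2 := fun x hx => by
    rw [← hnorm]
    have h1 : (2 * (√τ + √(b * a))) ^ 2 < ‖act A (WithLp.toLp 2 x)‖ ^ 2 := by gcongr
    have h2 := Real.sq_sqrt hτ0
    have h3 := Real.sq_sqrt (mul_nonneg hb0 ha)
    nlinarith [mul_nonneg (Real.sqrt_nonneg τ) (Real.sqrt_nonneg (b * a))]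
  -- The Chernoff weights have denominator 4b. When b = 0 all the weights e vanish, so the vector is
  -- zero and the strict inequality cannot hold.
  rcases hb0.eq_or_lt with rfl | hbpos
  · have hempty : (fun x : Fin n → ℝ => act A (WithLp.toLp 2 x)) ⁻¹'
        {g | 2 * (√τ + √(0 * a)) < ‖g‖} = ∅ := by
      refine Set.eq_empty_of_forall_notMem fun x hx => ?_
      have h1 := hsub x hx
      have h2 : ∑ j, e j * x j ^ 2 = 0 := Finset.sum_eq_zero fun j _ => by
        rw [le_antisymm (heb 0 hb j) (he0 j), zero_mul]
      linarith
    rw [hempty]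
    simp [Real.exp_nonneg]
  -- With weights e j/(4b) ≤ 1/4, the threshold 2τ + 4ba becomes a + τ/(2b). The moment generating
  -- factor is at most exp(tr S/(2b)), which the extra τ/(2b) absorbs, leaving exp(−a).
  · have ht : ∀ j, e j / (4 * b) < 1 / 2 := fun j => by
      rw [div_lt_iff₀ (by positivity)]
      linarith [heb b hb j]
    have h1 := measureReal_le_sum_mul_sq ht (a + τ / (2 * b))
    refine (measureReal_mono fun x hx => ?_).trans (h1.trans ?_)
    · have h2 := hsub x hx
      simp_rw [div_mul_eq_mul_div, ← Finset.sum_div]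
      rw [Set.mem_ofPred_eq, le_div_iff₀ (by positivity)]
      have h3 : (a + τ / (2 * b)) * (4 * b) = 2 * τ + 4 * (b * a) := by field_simp; ring
      linarith
    · have h3 : ∏ j, (√(1 - 2 * (e j / (4 * b))))⁻¹ ≤ ∏ j, Real.exp (2 * (e j / (4 * b))) := by
        refine Finset.prod_le_prod (fun j _ => by positivity) fun j _ => ?_
        refine inv_sqrt_one_sub_le_exp (by have := he0 j; positivity) ?_
        have : e j / (4 * b) ≤ 1 / 4 := by
          rw [div_le_iff₀ (by positivity)]
          linarith [heb b hb j]
        linarith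
      rw [← Real.exp_sum, ← Finset.mul_sum, ← Finset.sum_div, ← htr] at h3
      refine (mul_le_mul_of_nonneg_left h3 (Real.exp_nonneg _)).trans ?_
      rw [← Real.exp_add, Real.exp_le_exp]
      have h4 : τ / (2 * b) - 2 * (S.trace / (4 * b)) = (τ - S.trace) / (2 * b) := by
        field_simp
        ring
      have : 0 ≤ (τ - S.trace) / (2 * b) := div_nonneg (by linarith) (by positivity)
      linarith

/-- Tail bound for the norm of a weighted sum of independent centered Gaussian vectors. -/
lemma gaussian_sum_smul_tail {S : Matrix (Fin n) (Fin n) ℝ} (hS : S.PosSemidef) {τ b a : ℝ}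
    (hτ : S.trace ≤ τ) (hb0 : 0 ≤ b) (hb : ∀ v, ⟪v, act S v⟫ ≤ b * ‖v‖ ^ 2) (ha : 0 ≤ a)
    (u : Vec M) :
    (Measure.pi fun _ : Fin M => multivariateGaussian 0 S).real
      {Y | 2 * (√τ + √(b * a)) * ‖u‖ < ‖∑ i, u i • Y i‖} ≤ Real.exp (-a) := by
  have hm : Measurable fun Y : Fin M → Vec n => ∑ i, u i • Y i := by fun_prop
  have h := gaussian_norm_tail (S := ‖u‖ ^ 2 • S) (hS.smul (sq_nonneg _)) (τ := ‖u‖ ^ 2 * τ)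
    (b := ‖u‖ ^ 2 * b) (a := a) (by rw [Matrix.trace_smul, smul_eq_mul]; gcongr) (by positivity)
    (fun v => by
      rw [act_smul_left, inner_smul_right, mul_assoc]
      exact mul_le_mul_of_nonneg_left (hb v) (sq_nonneg _)) ha
  rw [← map_sum_smul_gaussian hS, map_measureReal_apply hm
    (measurableSet_lt (by fun_prop) (by fun_prop)), mul_assoc, Real.sqrt_mul (sq_nonneg _),
    Real.sqrt_mul (sq_nonneg _), Real.sqrt_sq (norm_nonneg _), ← mul_add, mul_left_comm,
    mul_comm ‖u‖] at h
  exact h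

end Norm

/-! ### A net on the unit sphere -/

section Net

variable {E : Type*} [NormedAddCommGroup E] [NormedSpace ℝ E] [FiniteDimensional ℝ E]

open Metric Module in
/-- Volume bound for separated subsets of the unit ball. -/
lemma card_le_of_separated_unitBall (s : Finset E) (hs : ∀ c ∈ s, ‖c‖ ≤ 1)
    (h : ∀ c ∈ s, ∀ d ∈ s, c ≠ d → 1 / 8 ≤ ‖c - d‖) : s.card ≤ 17 ^ finrank ℝ E := by
  borelize E
  let μ : Measure E := Measure.addHaar
  have hD : (s : Set E).Pairwise (Function.onFun Disjoint fun c => ball (c : E) (1 / 16)) := by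
    intro c hc d hd hcd
    refine ball_disjoint_ball ?_
    rw [dist_eq_norm]
    linarith [h c hc d hd hcd]
  -- Disjoint balls of radius 1/16 inside a ball of radius 17/16: the volume ratio is 17 to the
  -- dimension.
  have hA : (⋃ c ∈ s, ball (c : E) (1 / 16)) ⊆ ball 0 (17 / 16) := by
    refine Set.iUnion₂_subset fun x hx => ball_subset_ball' ?_
    rw [dist_zero_right]
    linarith [hs x hx]
  have h1 : (s.card : ENNReal) * ENNReal.ofReal ((1 / 16) ^ finrank ℝ E) * μ (ball 0 1)
      ≤ ENNReal.ofReal ((17 / 16) ^ finrank ℝ E) * μ (ball 0 1) := by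
    have h2 := measure_mono (μ := μ) hA
    rw [measure_biUnion_finset hD fun c _ => measurableSet_ball,
      μ.addHaar_ball_of_pos _ (by norm_num : (0 : ℝ) < 17 / 16)] at h2
    simpa only [μ.addHaar_ball_of_pos _ (by norm_num : (0 : ℝ) < 1 / 16), Finset.sum_const,
      nsmul_eq_mul, mul_assoc] using h2
  have h2 := (ENNReal.mul_le_mul_iff_left (measure_ball_pos _ _ zero_lt_one).ne'
    measure_ball_lt_top.ne).1 h1
  have h3 : (s.card : ℝ) ≤ 17 ^ finrank ℝ E := by
    have h4 := ENNReal.toReal_le_of_le_ofReal (by positivity) h2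
    rw [ENNReal.toReal_mul, ENNReal.toReal_natCast, ENNReal.toReal_ofReal (by positivity),
      div_pow, div_pow, one_pow, mul_one_div] at h4
    exact (div_le_div_iff_of_pos_right (by positivity)).1 h4
  exact mod_cast h3

variable (E) in
-- A maximal 1/8-separated subset of the sphere is a net. If no net of the allowed size existed,
-- every separated set could be enlarged, eventually beyond the volume bound.
lemma exists_sphere_net : ∃ N : Finset E, (∀ c ∈ N, ‖c‖ = 1) ∧
    N.card ≤ 17 ^ Module.finrank ℝ E ∧ ∀ v : E, ‖v‖ = 1 → ∃ c ∈ N, ‖v - c‖ < 1 / 8 := by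
  classical
  by_contra! hcon
  have key : ∀ k : ℕ, ∃ s : Finset E, s.card = k ∧ (∀ c ∈ s, ‖c‖ = 1) ∧
      ∀ c ∈ s, ∀ d ∈ s, c ≠ d → 1 / 8 ≤ ‖c - d‖ := by
    intro k
    induction k with
    | zero => exact ⟨∅, by simp⟩
    | succ k ih =>
      obtain ⟨s, hcard, h1, h2⟩ := ih
      obtain ⟨v, hv, hsep⟩ := hcon s h1
        (card_le_of_separated_unitBall s (fun c hc => (h1 c hc).le) h2)
      have hvs : v ∉ s := fun hmem => by
        have := hsep v hmem
        rw [sub_self, norm_zero] at this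
        norm_num at this
      refine ⟨insert v s, by rw [Finset.card_insert_of_notMem hvs, hcard], ?_, ?_⟩
      · intro c hc
        rcases Finset.mem_insert.1 hc with rfl | hc
        exacts [hv, h1 c hc]
      · intro c hc d hd hcd
        rcases Finset.mem_insert.1 hc with rfl | hcs <;>
          rcases Finset.mem_insert.1 hd with rfl | hds
        · exact absurd rfl hcd
        · exact hsep d hds
        · rw [norm_sub_rev]; exact hsep c hcs
        · exact h2 c hcs d hds hcd
  obtain ⟨s, hcard, h1, h2⟩ := key (17 ^ Module.finrank ℝ E + 1)
  have := card_le_of_separated_unitBall s (fun c hc => (h1 c hc).le) h2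
  omega

end Net

/-! ### The smallest singular value of a Gaussian design -/

section SingularValue

variable {n M : ℕ}

lemma act_design (X : Fin M → Vec n) (v : Vec n) :
    act (design X) v = WithLp.toLp 2 fun i => ⟪X i, v⟫ := by
  ext i
  exact (inner_eq_dotProduct (X i) v).symm

lemma norm_act_design_sq (X : Fin M → Vec n) (v : Vec n) :
    ‖act (design X) v‖ ^ 2 = ∑ i, ⟪X i, v⟫ ^ 2 := by
  rw [act_design, EuclideanSpace.real_norm_sq_eq]

lemma continuous_act_design (v : Vec n) :
    Continuous fun X : Fin M → Vec n => act (design X) v := by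
  simp_rw [act_design]
  fun_prop

lemma l2_opNorm_le_of_unit (A : Matrix (Fin M) (Fin n) ℝ) {C : ℝ} (hC : 0 ≤ C)
    (h : ∀ v : Vec n, ‖v‖ = 1 → ‖act A v‖ ≤ C) : ‖A‖ ≤ C := by
  rw [Matrix.l2_opNorm_def]
  exact ContinuousLinearMap.opNorm_le_of_unit_norm hC h

/-- Two-sided bounds on a net give a lower bound on the whole space. -/
lemma le_norm_act_of_net {A : Matrix (Fin M) (Fin n) ℝ} {N : Finset (Vec n)} {σ : ℝ} (hσ : 0 ≤ σ)
    (hN : ∀ v : Vec n, ‖v‖ = 1 → ∃ c ∈ N, ‖v - c‖ < 1 / 8)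
    (hlo : ∀ c ∈ N, σ / 2 ≤ ‖act A c‖) (hhi : ∀ c ∈ N, ‖act A c‖ ≤ 2 * σ) (v : Vec n) :
    σ / 5 * ‖v‖ ≤ ‖act A v‖ := by
  have hstep : ∀ w c : Vec n, ‖w - c‖ < 1 / 8 → ‖act A w - act A c‖ ≤ ‖A‖ * (1 / 8) :=
    fun w c hw => by
      rw [← act_sub_right]
      exact (norm_act_le _ _).trans (by gcongr)
  -- This self-bounding inequality gives ‖A‖ ≤ 16σ/7. Off the net the lower bound is then σ/2 − 2σ/7
  -- = 3σ/14 ≥ σ/5.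
  have hA : ‖A‖ ≤ 2 * σ + ‖A‖ * (1 / 8) := by
    refine l2_opNorm_le_of_unit A (by positivity) fun w hw => ?_
    obtain ⟨c, hc, hwc⟩ := hN w hw
    have h1 := norm_add_le (act A c) (act A w - act A c)
    rw [add_sub_cancel] at h1
    linarith [hhi c hc, hstep w c hwc]
  have hunit : ∀ w : Vec n, ‖w‖ = 1 → σ / 5 ≤ ‖act A w‖ := fun w hw => by
    obtain ⟨c, hc, hwc⟩ := hN w hw
    have h1 := norm_sub_norm_le (act A c) (act A w)
    rw [norm_sub_rev] at h1
    linarith [hlo c hc, hstep w c hwc]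
  rcases eq_or_ne v 0 with rfl | hv
  · simp
  · have h0 : 0 < ‖v‖ := norm_pos_iff.2 hv
    have h1 := hunit (‖v‖⁻¹ • v) (by rw [norm_smul, norm_inv, norm_norm, inv_mul_cancel₀ h0.ne'])
    rw [act_smul_right, norm_smul, norm_inv, norm_norm, inv_mul_eq_div, le_div_iff₀ h0] at h1
    exact h1

lemma map_inner_stdGaussian {c : Vec n} (hc : ‖c‖ = 1) :
    (stdGaussian (Vec n)).map (fun g => ⟪g, c⟫) = gaussianReal 0 1 := by
  have hm : Measurable fun g : Vec n => ⟪g, c⟫ := by fun_prop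
  have : IsProbabilityMeasure ((stdGaussian (Vec n)).map (fun g => ⟪g, c⟫)) :=
    Measure.isProbabilityMeasure_map hm.aemeasurable
  refine Measure.ext_of_charFun ?_
  ext t
  rw [charFun_apply_real, charFun_gaussianReal, integral_map hm.aemeasurable
    (Continuous.aestronglyMeasurable (by fun_prop))]
  have h := charFun_stdGaussian (E := Vec n) (t • c)
  rw [charFun_apply] at h
  simp_rw [real_inner_smul_right, norm_smul, hc] at h
  push_cast at h
  rw [h]
  simp [← Complex.ofReal_pow, neg_div]

lemma map_inner_pi_stdGaussian {c : Vec n} (hc : ‖c‖ = 1) :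
    (Measure.pi fun _ : Fin M => stdGaussian (Vec n)).map (fun X i => ⟪X i, c⟫)
      = Measure.pi fun _ : Fin M => gaussianReal 0 1 := by
  have : ∀ i : Fin M, SigmaFinite ((stdGaussian (Vec n)).map (fun g => ⟪g, c⟫)) := fun _ => by
    rw [map_inner_stdGaussian hc]; infer_instance
  rw [Measure.pi_map_pi (f := fun _ g => ⟪g, c⟫) fun _ => by fun_prop, map_inner_stdGaussian hc]

lemma measureReal_norm_act_design_lt {c : Vec n} (hc : ‖c‖ = 1) :
    (Measure.pi fun _ : Fin M => stdGaussian (Vec n)).real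
      {X | ‖act (design X) c‖ < √M / 2} ≤ Real.exp (-(M / 4)) := by
  have hm : Measurable fun (X : Fin M → Vec n) i => ⟪X i, c⟫ := by fun_prop
  -- Each coordinate contributes 1/√3 ≤ e^(−1/2), since e ≤ 3; the total is e^(M/4 − M/2).
  have h := measureReal_le_sum_mul_sq (ι := Fin M) (t := fun _ => -1) (by norm_num) (-(M / 4))
  rw [← map_inner_pi_stdGaussian hc,
    map_measureReal_apply hm (measurableSet_le (by fun_prop) (by fun_prop))] at h
  refine (measureReal_mono fun X hX => ?_).trans (h.trans ?_)
  · have h1 : ‖act (design X) c‖ ^ 2 < (√M / 2) ^ 2 := by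
      have : ‖act (design X) c‖ < √M / 2 := hX
      gcongr
    rw [norm_act_design_sq, div_pow, Real.sq_sqrt (Nat.cast_nonneg _)] at h1
    have h2 : -(M / 4 : ℝ) ≤ ∑ i, -1 * ⟪X i, c⟫ ^ 2 := by
      rw [← Finset.mul_sum]
      linarith
    exact h2
  · rw [Finset.prod_const, Finset.card_univ, Fintype.card_fin]
    have h3 : (√(1 - 2 * (-1 : ℝ)))⁻¹ ≤ Real.exp (-(1 / 2)) := by
      rw [Real.exp_neg]
      refine inv_anti₀ (Real.exp_pos _) (Real.le_sqrt_of_sq_le ?_)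
      rw [← Real.exp_nat_mul]
      norm_num
      linarith [Real.exp_one_lt_d9]
    calc Real.exp (- -(M / 4)) * (√(1 - 2 * (-1 : ℝ)))⁻¹ ^ M
        ≤ Real.exp (- -(M / 4)) * Real.exp (-(1 / 2)) ^ M := by gcongr
      _ = Real.exp (-(M / 4)) := by
          rw [← Real.exp_nat_mul, ← Real.exp_add]
          congr 1
          ring

lemma measureReal_lt_norm_act_design {c : Vec n} (hc : ‖c‖ = 1) :
    (Measure.pi fun _ : Fin M => stdGaussian (Vec n)).real
      {X | 2 * √M < ‖act (design X) c‖} ≤ Real.exp (-(M / 4)) := by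
  have hm : Measurable fun (X : Fin M → Vec n) i => ⟪X i, c⟫ := by fun_prop
  -- Each coordinate contributes √2 ≤ e^(1/2); the total e^(−M/2) is weakened to match the lower
  -- tail.
  have h := measureReal_le_sum_mul_sq (ι := Fin M) (t := fun _ => 1 / 4) (by norm_num) M
  rw [← map_inner_pi_stdGaussian hc,
    map_measureReal_apply hm (measurableSet_le (by fun_prop) (by fun_prop))] at h
  refine (measureReal_mono fun X hX => ?_).trans (h.trans ?_)
  · have h1 : (2 * √M) ^ 2 < ‖act (design X) c‖ ^ 2 := by
      have : 2 * √M < ‖act (design X) c‖ := hX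
      gcongr
    rw [norm_act_design_sq, mul_pow, Real.sq_sqrt (Nat.cast_nonneg _)] at h1
    have h2 : (M : ℝ) ≤ ∑ i, 1 / 4 * ⟪X i, c⟫ ^ 2 := by
      rw [← Finset.mul_sum]
      linarith
    exact h2
  · rw [Finset.prod_const, Finset.card_univ, Fintype.card_fin]
    have h3 : (√(1 - 2 * (1 / 4 : ℝ)))⁻¹ ≤ Real.exp (1 / 2) := by
      rw [show (2 : ℝ) * (1 / 4) = 1 / 2 by norm_num]
      exact inv_sqrt_one_sub_le_exp (by norm_num) le_rfl
    calc Real.exp (-M) * (√(1 - 2 * (1 / 4 : ℝ)))⁻¹ ^ M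
        ≤ Real.exp (-M) * Real.exp (1 / 2) ^ M := by gcongr
      _ = Real.exp (-(M / 2)) := by
          rw [← Real.exp_nat_mul, ← Real.exp_add]
          congr 1
          ring
      _ ≤ Real.exp (-(M / 4)) := by
          rw [Real.exp_le_exp]
          have : (0 : ℝ) ≤ M := Nat.cast_nonneg M
          linarith

/-- A union bound over at most 17^n net points, with a lower and an upper tail event at each; the
net argument then controls all directions. -/
lemma stdGaussian_design_tail :
    (Measure.pi fun _ : Fin M => stdGaussian (Vec n)).real
      {X | ¬ ∀ v, √M / 5 * ‖v‖ ≤ ‖act (design X) v‖} ≤ 2 * 17 ^ n * Real.exp (-(M / 4)) := by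
  obtain ⟨N, hN1, hNcard, hN⟩ := exists_sphere_net (Vec n)
  rw [finrank_euclideanSpace_fin] at hNcard
  set μ := Measure.pi fun _ : Fin M => stdGaussian (Vec n) with hμ
  have : IsProbabilityMeasure μ := by rw [hμ]; infer_instance
  have hsub : {X : Fin M → Vec n | ¬ ∀ v, √M / 5 * ‖v‖ ≤ ‖act (design X) v‖}
      ⊆ ⋃ c ∈ N, ({X | ‖act (design X) c‖ < √M / 2} ∪ {X | 2 * √M < ‖act (design X) c‖}) := by
    intro X hX
    by_contra hcon
    simp only [Set.mem_iUnion, Set.mem_union, Set.mem_ofPred_eq, not_exists, not_or, not_lt] at hcon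
    exact hX (le_norm_act_of_net (Real.sqrt_nonneg _) hN (fun c hc => (hcon c hc).1)
      fun c hc => (hcon c hc).2)
  calc _ ≤ μ.real (⋃ c ∈ N,
        ({X | ‖act (design X) c‖ < √M / 2} ∪ {X | 2 * √M < ‖act (design X) c‖})) :=
        measureReal_mono hsub (measure_ne_top _ _)
    _ ≤ ∑ c ∈ N, μ.real
        ({X | ‖act (design X) c‖ < √M / 2} ∪ {X | 2 * √M < ‖act (design X) c‖}) :=
        measureReal_biUnion_finset_le _ _
    _ ≤ ∑ c ∈ N, 2 * Real.exp (-(M / 4)) := by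
        refine Finset.sum_le_sum fun c hc => (measureReal_union_le _ _).trans ?_
        linarith [measureReal_norm_act_design_lt (M := M) (hN1 c hc),
          measureReal_lt_norm_act_design (M := M) (hN1 c hc)]
    _ = N.card * (2 * Real.exp (-(M / 4))) := by rw [Finset.sum_const, nsmul_eq_mul]
    _ ≤ 17 ^ n * (2 * Real.exp (-(M / 4))) := by
        gcongr
        exact mod_cast hNcard
    _ = _ := by ring

/-- Supplies the measurability of an event defined by uncountably many directions. -/
lemma isClosed_le_design (σ : ℝ) :
    IsClosed {X : Fin M → Vec n | ∀ v, σ * ‖v‖ ≤ ‖act (design X) v‖} := by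
  simp only [Set.ofPred_forall]
  exact isClosed_iInter fun v => isClosed_le continuous_const (continuous_act_design v).norm

/-- Lower tail of the smallest singular value of a Gaussian design. -/
lemma gaussian_design_tail {S : Matrix (Fin n) (Fin n) ℝ} (hS : S.PosSemidef) {κ : ℝ} (hκ : 0 ≤ κ)
    (h : ∀ v, κ * ‖v‖ ^ 2 ≤ ⟪v, act S v⟫) :
    (Measure.pi fun _ : Fin M => multivariateGaussian 0 S).real
      {X | ¬ ∀ v, √(κ * M) / 5 * ‖v‖ ≤ ‖act (design X) v‖}
      ≤ 2 * 17 ^ n * Real.exp (-(M / 4)) := by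
  obtain ⟨A, e, hA, -⟩ := exists_mul_transpose_eq hS
  have hlaw : (Measure.pi fun _ : Fin M => multivariateGaussian 0 S)
      = (Measure.pi fun _ : Fin M => stdGaussian (Vec n)).map (fun X i => act A (X i)) := by
    have h1 := map_act_gaussian (Matrix.PosSemidef.one (n := Fin n) (R := ℝ)) A
    rw [Matrix.mul_one, ← hA, multivariateGaussian_zero_one] at h1
    have : ∀ i : Fin M, SigmaFinite ((stdGaussian (Vec n)).map (act A)) := fun _ => by
      rw [h1]; infer_instance
    rw [Measure.pi_map_pi fun _ => (continuous_act A).aemeasurable, h1]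
  have hm : Measurable fun (X : Fin M → Vec n) i => act A (X i) :=
    measurable_pi_lambda _ fun i => (continuous_act A).measurable.comp (measurable_pi_apply i)
  rw [hlaw, ← Set.compl_ofPred, map_measureReal_apply hm (isClosed_le_design _).measurableSet.compl]
  refine le_trans (measureReal_mono ?_ (measure_ne_top _ _)) stdGaussian_design_tail
  intro X hX hgood
  refine hX fun v => ?_
  -- The correlated design is the standard one composed with Aᵀ, and S = AAᵀ gives ‖Aᵀv‖² = ⟪v, Sv⟫
  -- ≥ κ‖v‖².
  have h1 : ‖act (design fun i => act A (X i)) v‖ = ‖act (design X) (act Aᵀ v)‖ := by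
    simp_rw [act_design, inner_act_left]
  have h2 : √κ * ‖v‖ ≤ ‖act Aᵀ v‖ := by
    refine abs_le_of_sq_le_sq' ?_ (norm_nonneg _) |>.2
    rw [mul_pow, Real.sq_sqrt hκ, ← inner_act_gram, Matrix.transpose_transpose, ← hA]
    exact h v
  rw [h1, Real.sqrt_mul hκ]
  calc _ = √M / 5 * (√κ * ‖v‖) := by ring
    _ ≤ √M / 5 * ‖act Aᵀ v‖ := by gcongr
    _ ≤ _ := hgood _

end SingularValue

/-! ### Decorrelating the nuisance coordinates -/

section Decorrelate

variable {d r m : ℕ}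

/-- `V - U Λ₁₁⁻¹ Λ₁₂`, which is `Λ`-orthogonal to `U`. -/
def residual (Lam : Matrix (Fin d) (Fin d) ℝ) (U : Matrix (Fin d) (Fin r) ℝ)
    (V : Matrix (Fin d) (Fin m) ℝ) : Matrix (Fin d) (Fin m) ℝ :=
  V - U * ((Uᵀ * Lam * U)⁻¹ * (Uᵀ * Lam * V))

variable {Lam : Matrix (Fin d) (Fin d) ℝ} {U : Matrix (Fin d) (Fin r) ℝ}
  {V : Matrix (Fin d) (Fin m) ℝ}

lemma transpose_mul_mul_residual (h : IsUnit (Uᵀ * Lam * U).det) :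
    Uᵀ * Lam * residual Lam U V = 0 := by
  rw [residual, Matrix.mul_sub, ← Matrix.mul_assoc (Uᵀ * Lam), ← Matrix.mul_assoc (Uᵀ * Lam * U),
    Matrix.mul_nonsing_inv _ h, Matrix.one_mul, sub_self]

lemma posSemidef_transpose_mul_mul (hL : Lam.PosSemidef) (W : Matrix (Fin d) (Fin m) ℝ) :
    (Wᵀ * Lam * W).PosSemidef := by
  simpa using hL.conjTranspose_mul_mul_same W

lemma transpose_eq_of_posSemidef (hL : Lam.PosSemidef) : Lamᵀ = Lam := by
  simpa [Matrix.IsHermitian] using hL.isHermitian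

/-- A Pythagorean identity: V = W + UC with W the residual, and the cross terms vanish by
Λ-orthogonality. Since the last summand is positive semidefinite, the residual covariance inherits
the trace and norm bounds of Λ₂₂. -/
lemma residual_cov_add (hL : Lam.PosSemidef) (h : IsUnit (Uᵀ * Lam * U).det) :
    Vᵀ * Lam * V = (residual Lam U V)ᵀ * Lam * residual Lam U V
      + ((Uᵀ * Lam * U)⁻¹ * (Uᵀ * Lam * V))ᵀ * (Uᵀ * Lam * U)
        * ((Uᵀ * Lam * U)⁻¹ * (Uᵀ * Lam * V)) := by
  have h0 := transpose_mul_mul_residual (V := V) h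
  have h0' : (residual Lam U V)ᵀ * Lam * U = 0 := by
    have := congrArg Matrix.transpose h0
    simpa [Matrix.transpose_mul, transpose_eq_of_posSemidef hL, Matrix.mul_assoc] using this
  have hV : V = residual Lam U V + U * ((Uᵀ * Lam * U)⁻¹ * (Uᵀ * Lam * V)) := by
    rw [residual, sub_add_cancel]
  set C := (Uᵀ * Lam * U)⁻¹ * (Uᵀ * Lam * V)
  set W := residual Lam U V
  calc Vᵀ * Lam * V = (W + U * C)ᵀ * Lam * (W + U * C) := by rw [← hV]
    _ = Wᵀ * Lam * W + Wᵀ * Lam * U * C + Cᵀ * (Uᵀ * Lam * W) + Cᵀ * (Uᵀ * Lam * U) * C := by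
        simp only [Matrix.transpose_add, Matrix.transpose_mul, Matrix.add_mul, Matrix.mul_add,
          Matrix.mul_assoc]
        abel
    _ = _ := by rw [h0, h0', Matrix.zero_mul, Matrix.mul_zero, add_zero, add_zero]

lemma trace_residual_cov_le (hL : Lam.PosSemidef) (h : IsUnit (Uᵀ * Lam * U).det) :
    ((residual Lam U V)ᵀ * Lam * residual Lam U V).trace ≤ (Vᵀ * Lam * V).trace := by
  have h1 := (posSemidef_transpose_mul_mul (posSemidef_transpose_mul_mul hL U)
    ((Uᵀ * Lam * U)⁻¹ * (Uᵀ * Lam * V))).trace_nonneg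
  rw [residual_cov_add (V := V) hL h, Matrix.trace_add]
  linarith

lemma inner_residual_cov_le (hL : Lam.PosSemidef) (h : IsUnit (Uᵀ * Lam * U).det) (v : Vec m) :
    ⟪v, act ((residual Lam U V)ᵀ * Lam * residual Lam U V) v⟫ ≤ ‖Vᵀ * Lam * V‖ * ‖v‖ ^ 2 := by
  have h1 := inner_act_nonneg (posSemidef_transpose_mul_mul (posSemidef_transpose_mul_mul hL U)
    ((Uᵀ * Lam * U)⁻¹ * (Uᵀ * Lam * V))) v
  have h2 := (real_inner_le_norm v (act (Vᵀ * Lam * V) v)).trans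
    (mul_le_mul_of_nonneg_left (norm_act_le (Vᵀ * Lam * V) v) (norm_nonneg _))
  have h3 : ⟪v, act (Vᵀ * Lam * V) v⟫
      = ⟪v, act ((residual Lam U V)ᵀ * Lam * residual Lam U V) v⟫
        + ⟪v, act (((Uᵀ * Lam * U)⁻¹ * (Uᵀ * Lam * V))ᵀ * (Uᵀ * Lam * U)
          * ((Uᵀ * Lam * U)⁻¹ * (Uᵀ * Lam * V))) v⟫ := by
    rw [← inner_add_right, ← act_add_left, ← residual_cov_add hL h]
  nlinarith

/-- `Λ`-orthogonal linear images of a centered Gaussian vector are independent. -/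
lemma map_act_prod_gaussian (hL : Lam.PosSemidef) {W : Matrix (Fin d) (Fin m) ℝ}
    (h : Uᵀ * Lam * W = 0) :
    (multivariateGaussian 0 Lam).map (fun x => (act Uᵀ x, act Wᵀ x))
      = (multivariateGaussian 0 (Uᵀ * Lam * U)).prod (multivariateGaussian 0 (Wᵀ * Lam * W)) := by
  have hU := map_act_gaussian hL Uᵀ
  have hW := map_act_gaussian hL Wᵀ
  rw [Matrix.transpose_transpose] at hU hW
  have hlaw : HasGaussianLaw (fun x => (act Uᵀ x, act Wᵀ x)) (multivariateGaussian 0 Lam) :=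
    (IsGaussian.hasGaussianLaw_id (μ := multivariateGaussian 0 Lam)).map
      ((LinearMap.toContinuousLinearMap (Matrix.toEuclideanLin Uᵀ)).prod
        (LinearMap.toContinuousLinearMap (Matrix.toEuclideanLin Wᵀ)))
  have hind : IndepFun (act Uᵀ) (act Wᵀ) (multivariateGaussian 0 Lam) := by
    refine hlaw.indepFun_of_covariance_inner fun x y => ?_
    simp_rw [inner_act_right, Matrix.transpose_transpose]
    rw [← covarianceBilin_apply_eq_cov IsGaussian.memLp_two_id,
      covarianceBilin_multivariateGaussian hL]
    have h1 : ⟪act U x, act Lam (act W y)⟫ = 0 := by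
      rw [inner_act_left, ← act_mul, ← act_mul, h, act_zero_left, inner_zero_right]
    rw [← h1, inner_eq_dotProduct]
    rfl
  rw [(indepFun_iff_map_prod_eq_prod_map_map (continuous_act _).aemeasurable
    (continuous_act _).aemeasurable).1 hind, hU, hW]

/-- Conditioning on the concept design becomes integration over one factor of a product measure. -/
lemma measurePreserving_split (hL : Lam.PosSemidef) {W : Matrix (Fin d) (Fin m) ℝ}
    (h : Uᵀ * Lam * W = 0) (M : ℕ) :
    MeasurePreserving
      (fun X : Fin M → Vec d => ((fun i => act Uᵀ (X i)), (fun i => act Wᵀ (X i))))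
      (Measure.pi fun _ => multivariateGaussian 0 Lam)
      ((Measure.pi fun _ => multivariateGaussian 0 (Uᵀ * Lam * U)).prod
        (Measure.pi fun _ => multivariateGaussian 0 (Wᵀ * Lam * W))) := by
  have hm : Measurable fun x : Vec d => (act Uᵀ x, act Wᵀ x) :=
    ((continuous_act _).prodMk (continuous_act _)).measurable
  have h1 : MeasurePreserving (fun (X : Fin M → Vec d) i => (act Uᵀ (X i), act Wᵀ (X i)))
      (Measure.pi fun _ => multivariateGaussian 0 Lam)
      (Measure.pi fun _ => (multivariateGaussian 0 (Uᵀ * Lam * U)).prod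
        (multivariateGaussian 0 (Wᵀ * Lam * W))) := by
    refine measurePreserving_pi _ _ fun _ => ⟨hm, map_act_prod_gaussian hL h⟩
  exact (measurePreserving_arrowProdEquivProdArrow _ _ _ _ _).comp h1

end Decorrelate

/-! ### Tail bounds for the cross vectors -/

section Cross

variable {d r m M : ℕ}

/-- `Z (ZᵀZ + c)⁻¹ b` for the design with rows `Y i`. -/
def hatVec (c : ℝ) (b : Vec r) (Y : Fin M → Vec r) : Vec M :=
  act (design Y) (act (gramReg (design Y) c)⁻¹ b)

/-- Needed for measurability of the tail event. Inversion causes no trouble because c > 0 keeps the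
determinant nonzero. -/
lemma continuous_hatVec {c : ℝ} (hc : 0 < c) :
    Continuous fun p : Vec r × (Fin M → Vec r) => hatVec c p.1 p.2 := by
  have hd : Continuous fun p : Vec r × (Fin M → Vec r) => design p.2 :=
    continuous_matrix fun i j => by
      simp only [design, Matrix.of_apply]
      fun_prop
  have hg : Continuous fun p : Vec r × (Fin M → Vec r) => gramReg (design p.2) c :=
    (hd.matrix_transpose.matrix_mul hd).add continuous_const
  have hi : Continuous fun p : Vec r × (Fin M → Vec r) => (gramReg (design p.2) c)⁻¹ := by
    simp_rw [Matrix.inv_def, Ring.inverse_eq_inv']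
    exact (hg.matrix_det.inv₀ fun p => (isUnit_det_gramReg (design p.2) hc).ne_zero).smul
      hg.matrix_adjugate
  have hv : Continuous fun p : Vec r × (Fin M → Vec r) => p.1.ofLp := by fun_prop
  exact (PiLp.continuous_toLp 2 _).comp (hd.matrix_mulVec (hi.matrix_mulVec hv))

lemma prod_measure_le_of_forall {α β : Type*} [MeasurableSpace α] [MeasurableSpace β]
    {μ : Measure α} [IsProbabilityMeasure μ] {ν : Measure β} [SFinite ν] {s : Set (α × β)}
    (hs : MeasurableSet s) {ε : ENNReal} (h : ∀ a, ν (Prod.mk a ⁻¹' s) ≤ ε) :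
    (μ.prod ν) s ≤ ε := by
  rw [Measure.prod_apply hs]
  calc _ ≤ ∫⁻ _, ε ∂μ := lintegral_mono h
    _ = ε := by simp

/-- Conditionally on the concept coordinates, the decorrelated nuisance part of the cross vector is
Gaussian. -/
lemma hatVec_tail {Lam : Matrix (Fin d) (Fin d) ℝ} (hL : Lam.PosSemidef)
    {U : Matrix (Fin d) (Fin r) ℝ} {W : Matrix (Fin d) (Fin m) ℝ} (h : Uᵀ * Lam * W = 0)
    {c τ b a : ℝ} (hc : 0 < c) (hτ : (Wᵀ * Lam * W).trace ≤ τ) (hb0 : 0 ≤ b)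
    (hb : ∀ v, ⟪v, act (Wᵀ * Lam * W) v⟫ ≤ b * ‖v‖ ^ 2) (ha : 0 ≤ a)
    {Ω : Type*} [MeasurableSpace Ω] (ν : Measure Ω) [IsProbabilityMeasure ν] {f : Ω → Vec r}
    (hf : Measurable f) :
    (ν.prod (Measure.pi fun _ : Fin M => multivariateGaussian 0 Lam))
      {p | 2 * (√τ + √(b * a)) * ‖hatVec c (f p.1) fun i => act Uᵀ (p.2 i)‖
        < ‖∑ i, (hatVec c (f p.1) fun i => act Uᵀ (p.2 i)) i • act Wᵀ (p.2 i)‖}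
      ≤ ENNReal.ofReal (Real.exp (-a)) := by
  set N₁ := Measure.pi fun _ : Fin M => multivariateGaussian (0 : Vec r) (Uᵀ * Lam * U)
  set N₂ := Measure.pi fun _ : Fin M => multivariateGaussian (0 : Vec m) (Wᵀ * Lam * W) with hN₂
  -- Regrouping places (ω, Z) first and the residual design last, so for fixed (ω, Z) the weights
  -- are constants. The abstract source ω allows b to be either β or the concept part of the query.
  have hmp : MeasurePreserving
      (fun p : Ω × (Fin M → Vec d) =>
        ((p.1, fun i => act Uᵀ (p.2 i)), fun i => act Wᵀ (p.2 i)))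
      (ν.prod (Measure.pi fun _ : Fin M => multivariateGaussian 0 Lam)) ((ν.prod N₁).prod N₂) :=
    ((measurePreserving_prodAssoc ν N₁ N₂).symm).comp
      ((MeasurePreserving.id ν).prod (measurePreserving_split hL h M))
  have hu : Measurable fun p : (Ω × (Fin M → Vec r)) × (Fin M → Vec m) =>
      hatVec c (f p.1.1) p.1.2 :=
    (continuous_hatVec hc).measurable.comp
      ((hf.comp measurable_fst.fst).prodMk measurable_fst.snd)
  have hmeas : MeasurableSet {p : (Ω × (Fin M → Vec r)) × (Fin M → Vec m) |
      2 * (√τ + √(b * a)) * ‖hatVec c (f p.1.1) p.1.2‖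
        < ‖∑ i, (hatVec c (f p.1.1) p.1.2) i • p.2 i‖} := by
    refine measurableSet_lt (hu.norm.const_mul _) (Measurable.norm ?_)
    refine Finset.measurable_sum _ fun i _ => ?_
    have hui := (by fun_prop : Measurable fun u : Vec M => u i).comp hu
    exact hui.smul ((measurable_pi_apply i).comp measurable_snd)
  have hle : ((ν.prod N₁).prod N₂) {p | 2 * (√τ + √(b * a)) * ‖hatVec c (f p.1.1) p.1.2‖
        < ‖∑ i, (hatVec c (f p.1.1) p.1.2) i • p.2 i‖} ≤ ENNReal.ofReal (Real.exp (-a)) := by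
    refine prod_measure_le_of_forall hmeas fun q => ?_
    have h1 := gaussian_sum_smul_tail (posSemidef_transpose_mul_mul hL W) hτ hb0 hb ha
      (hatVec c (f q.1) q.2)
    rw [measureReal_def, ← ENNReal.le_ofReal_iff_toReal_le (measure_ne_top _ _)
      (Real.exp_nonneg _)] at h1
    exact h1
  rw [← hmp.measure_preimage hmeas.nullMeasurableSet] at hle
  exact hle

/-- The cross vector is bounded by its decorrelated part plus the contribution of the
cross-covariance. -/
lemma norm_crossVec_le {Lam : Matrix (Fin d) (Fin d) ℝ} (hL : Lam.PosSemidef)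
    {U : Matrix (Fin d) (Fin r) ℝ} (V : Matrix (Fin d) (Fin m) ℝ) (X : Fin M → Vec d)
    {κ c : ℝ} (hκ : 0 < κ) (hc : 0 < c) (h : ∀ v, κ * ‖v‖ ^ 2 ≤ ⟪v, act (Uᵀ * Lam * U) v⟫)
    (b : Vec r) :
    ‖crossVec U V X c b‖
      ≤ ‖∑ i, (hatVec c b fun i => act Uᵀ (X i)) i • act (residual Lam U V)ᵀ (X i)‖
        + ‖Uᵀ * Lam * V‖ * (‖b‖ / κ) := by
  have hdet := isUnit_det_of_le_inner hκ h
  set C := (Uᵀ * Lam * U)⁻¹ * (Uᵀ * Lam * V) with hC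
  have hV : conceptDesign V X = conceptDesign (residual Lam U V) X + conceptDesign U X * C := by
    simp_rw [conceptDesign_eq]
    rw [Matrix.mul_assoc, ← Matrix.mul_add, residual, sub_add_cancel]
  have hhat : act (conceptDesign U X) (act (gramReg (conceptDesign U X) c)⁻¹ b)
      = hatVec c b fun i => act Uᵀ (X i) := rfl
  have h1 : crossVec U V X c b
      = ∑ i, (hatVec c b fun i => act Uᵀ (X i)) i • act (residual Lam U V)ᵀ (X i)
        + act Cᵀ (act (conceptDesign U X)ᵀ
            (act (conceptDesign U X) (act (gramReg (conceptDesign U X) c)⁻¹ b))) := by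
    rw [sum_smul_eq_act, crossVec, hV, Matrix.transpose_add, act_add_left, Matrix.transpose_mul,
      act_mul Cᵀ, hhat]
    rfl
  have h2 := norm_gram_gramReg_inv_le (conceptDesign U X) hc b
  set y := act (conceptDesign U X)ᵀ
    (act (conceptDesign U X) (act (gramReg (conceptDesign U X) c)⁻¹ b))
  -- Coercivity of Λ₁₁ at Λ₁₁⁻¹y, followed by Cauchy–Schwarz.
  have h3 : ‖act (Uᵀ * Lam * U)⁻¹ y‖ ≤ ‖y‖ / κ := by
    have h4 := h (act (Uᵀ * Lam * U)⁻¹ y)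
    rw [act_act_inv hdet] at h4
    have h5 := real_inner_le_norm (act (Uᵀ * Lam * U)⁻¹ y) y
    rw [le_div_iff₀ hκ]
    rcases (norm_nonneg (act (Uᵀ * Lam * U)⁻¹ y)).eq_or_lt with h0 | h0
    · rw [← h0, zero_mul]; positivity
    · exact le_of_mul_le_mul_left (by nlinarith) h0
  have hCT : Cᵀ = (Uᵀ * Lam * V)ᵀ * (Uᵀ * Lam * U)⁻¹ := by
    rw [hC, Matrix.transpose_mul, Matrix.transpose_nonsing_inv,
      transpose_eq_of_posSemidef (posSemidef_transpose_mul_mul hL U)]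
  have hT : ‖(Uᵀ * Lam * V)ᵀ‖ = ‖Uᵀ * Lam * V‖ := by
    rw [← Matrix.conjTranspose_eq_transpose_of_trivial, Matrix.l2_opNorm_conjTranspose]
  rw [h1]
  refine (norm_add_le _ _).trans (add_le_add_right ?_ _)
  rw [hCT, act_mul]
  calc _ ≤ ‖(Uᵀ * Lam * V)ᵀ‖ * ‖act (Uᵀ * Lam * U)⁻¹ y‖ := norm_act_le _ _
    _ ≤ ‖Uᵀ * Lam * V‖ * (‖b‖ / κ) := by
        rw [hT]
        exact mul_le_mul_of_nonneg_left (h3.trans (by gcongr)) (norm_nonneg _)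

end Cross

/-! ### The main estimate -/

/-- The failure set need not be measurable, so the good event is the complement of its measurable
hull. -/
lemma holdsWithProb_of_measure_not_le {Ω : Type*} [MeasurableSpace Ω] {μ : Measure Ω}
    [IsProbabilityMeasure μ] {δ : ℝ} (hδ : 0 ≤ δ) {P : Ω → Prop}
    (h : μ {ω | ¬ P ω} ≤ ENNReal.ofReal δ) : HoldsWithProb μ δ P := by
  refine ⟨(toMeasurable μ {ω | ¬ P ω})ᶜ, (measurableSet_toMeasurable _ _).compl, ?_, ?_⟩
  · rw [prob_compl_eq_one_sub (measurableSet_toMeasurable _ _), measure_toMeasurable,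
      ENNReal.ofReal_sub _ hδ, ENNReal.ofReal_one]
    exact tsub_le_tsub_left h _
  · intro ω hω
    by_contra hP
    exact hω (subset_toMeasurable _ _ hP)

/-- Origin of the constant 20: 2·17^r ≤ e^(1 + 4r), while M/4 ≥ 5r + 5 log(4/δ), and r ≥ 1 absorbs
the leftover 1. -/
lemma two_mul_pow_mul_exp_le {r M : ℕ} {δ : ℝ} (hr : 1 ≤ r) (hδ : 0 < δ) (hδ1 : δ < 1)
    (hM : 20 * effDim 4 r δ ≤ M) : 2 * 17 ^ r * Real.exp (-((M : ℝ) / 4)) ≤ δ / 4 := by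
  have hlog : 0 ≤ Real.log (4 / δ) := Real.log_nonneg (by rw [le_div_iff₀ hδ]; linarith)
  have hr' : (1 : ℝ) ≤ r := mod_cast hr
  have h17 : (17 : ℝ) ≤ Real.exp 4 := by
    have h1 := Real.exp_one_gt_d9
    have h2 : Real.exp 4 = Real.exp 1 ^ 4 := by rw [← Real.exp_nat_mul]; norm_num
    rw [h2]
    calc (17 : ℝ) ≤ 2.7 ^ 4 := by norm_num
      _ ≤ _ := by gcongr; linarith
  have h2 : (2 : ℝ) ≤ Real.exp 1 := by linarith [Real.exp_one_gt_d9]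
  have hexp : Real.exp (-Real.log (4 / δ)) = δ / 4 := by
    rw [Real.exp_neg, Real.exp_log (by positivity), inv_div]
  calc 2 * 17 ^ r * Real.exp (-((M : ℝ) / 4))
      ≤ Real.exp 1 * Real.exp 4 ^ r * Real.exp (-((M : ℝ) / 4)) := by gcongr
    _ = Real.exp (1 + r * 4 + -((M : ℝ) / 4)) := by
        rw [← Real.exp_nat_mul, ← Real.exp_add, ← Real.exp_add]
    _ ≤ Real.exp (-Real.log (4 / δ)) := by
        rw [effDim] at hM
        rw [Real.exp_le_exp]
        linarith
    _ = δ / 4 := hexp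

/-- The error bounds for a general cross-covariance bound `ρ`, with explicit constants. -/
lemma holdsWithProb_errorBounds {κ c : ℝ} (hκ : 0 < κ) (hc : 0 < c) {r d M : ℕ}
    {Lam : Matrix (Fin d) (Fin d) ℝ} {U : Matrix (Fin d) (Fin r) ℝ}
    {V : Matrix (Fin d) (Fin (d - r)) ℝ} {δ : ℝ} (hr : 1 ≤ r) (hL : Lam.PosSemidef)
    (hUV : IsOrthonormalComplement U V)
    (hκL : (Uᵀ * Lam * U - κ • (1 : Matrix (Fin r) (Fin r) ℝ)).PosSemidef) (hδ : 0 < δ)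
    (hδ1 : δ < 1) (hM : 20 * effDim 4 r δ ≤ M) {ρ : ℝ} (hρ : ‖Uᵀ * Lam * V‖ ≤ ρ) :
    HoldsWithProb (dataLaw r d M Lam) δ fun ω =>
      ErrorBounds U V (c / M) (100 * c / κ) ((1 + 40 / √κ) ^ 2) (effDim 4 r δ)
        (nuisanceRate 4 (Vᵀ * Lam * V) r M δ + 4 / κ * ρ * √(effDim 4 r δ))
        (nuisanceRadius 4 (Vᵀ * Lam * V) δ / √M + 1 / κ * ρ) ω.1 ω.2.1 ω.2.2 := by
  have hlog : 0 ≤ Real.log (4 / δ) := Real.log_nonneg (by rw [le_div_iff₀ hδ]; linarith)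
  have hr' : (1 : ℝ) ≤ r := mod_cast hr
  have hLd : effDim 4 r δ = r + Real.log (4 / δ) := rfl
  have hMpos : (0 : ℝ) < M := by linarith
  have hexp : Real.exp (-Real.log (4 / δ)) = δ / 4 := by
    rw [Real.exp_neg, Real.exp_log (by positivity), inv_div]
  have hκv : ∀ v, κ * ‖v‖ ^ 2 ≤ ⟪v, act (Uᵀ * Lam * U) v⟫ := fun v => by
    have h := inner_act_nonneg hκL v
    rw [act_sub_left, act_smul_left, act_one, inner_sub_right, inner_smul_right,
      real_inner_self_eq_norm_sq] at h
    linarith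
  have hdet := isUnit_det_of_le_inner hκ hκv
  have horth := transpose_mul_mul_residual (V := V) hdet
  set R := nuisanceRadius 4 (Vᵀ * Lam * V) δ with hR
  have hR0 : 0 ≤ R := by rw [hR, nuisanceRadius]; positivity
  set L := effDim 4 r δ
  set P := Measure.pi fun _ : Fin M => multivariateGaussian (0 : Vec d) Lam with hP
  set Q := multivariateGaussian (0 : Vec d) Lam with hQ
  set B := multivariateGaussian (0 : Vec r) (1 : Matrix (Fin r) (Fin r) ℝ) with hB
  have hμ : dataLaw r d M Lam = B.prod (P.prod Q) := rfl
  have hBp : IsProbabilityMeasure B := by rw [hB]; infer_instance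
  have hQp : IsProbabilityMeasure Q := by rw [hQ]; infer_instance
  have hPp : IsProbabilityMeasure P := by rw [hP]; infer_instance
  rw [hμ]
  have tail := fun {Ω : Type} [MeasurableSpace Ω] (ν : Measure Ω) [IsProbabilityMeasure ν]
      {f : Ω → Vec r} (hf : Measurable f) =>
    hatVec_tail (M := M) hL horth hc (trace_residual_cov_le hL hdet) (norm_nonneg (Vᵀ * Lam * V))
      (inner_residual_cov_le hL hdet) hlog ν hf
  rw [hexp] at tail
  set W := residual Lam U V
  -- Four bad events of probability at most δ/4 each: an ill-conditioned Z, a large β, and a large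
  -- decorrelated cross vector for b = β and for b = Uᵀx. Their number fixes a₀ = 4.
  let E₁ : Set (Fin M → Vec r) := {Y | ¬ ∀ v, √(κ * M) / 5 * ‖v‖ ≤ ‖act (design Y) v‖}
  let E₂ : Set (Vec r) := {g | 2 * (√(r : ℝ) + √(1 * Real.log (4 / δ))) < ‖g‖}
  let E₃ (b : Vec r) (X : Fin M → Vec d) : Prop :=
    2 * R * ‖hatVec c b fun i => act Uᵀ (X i)‖
      < ‖∑ i, (hatVec c b fun i => act Uᵀ (X i)) i • act Wᵀ (X i)‖
  have h₁ : (B.prod (P.prod Q)) {ω | (fun i => act Uᵀ (ω.2.1 i)) ∈ E₁} ≤ ENNReal.ofReal (δ / 4) := by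
    have hlaw : MeasurePreserving (fun (X : Fin M → Vec d) i => act Uᵀ (X i)) P
        (Measure.pi fun _ => multivariateGaussian 0 (Uᵀ * Lam * U)) :=
      measurePreserving_pi _ _ fun _ => ⟨(continuous_act _).measurable, by
        simpa using map_act_gaussian hL Uᵀ⟩
    have hmp := (hlaw.comp (measurePreserving_fst (μ := P) (ν := Q))).comp
      (measurePreserving_snd (μ := B) (ν := P.prod Q))
    have h := (gaussian_design_tail (M := M) (posSemidef_transpose_mul_mul hL U) hκ.le hκv).trans
      (two_mul_pow_mul_exp_le hr hδ hδ1 hM)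
    rw [measureReal_def, ← ENNReal.le_ofReal_iff_toReal_le (measure_ne_top _ _) (by positivity),
      ← Set.compl_ofPred, ← hmp.measure_preimage (isClosed_le_design _).measurableSet.compl.nullMeasurableSet] at h
    exact h
  have h₂ : (B.prod (P.prod Q)) {ω | ω.1 ∈ E₂} ≤ ENNReal.ofReal (δ / 4) := by
    have h := gaussian_norm_tail (Matrix.PosSemidef.one (n := Fin r) (R := ℝ)) (τ := r) (b := 1)
      (by simp) zero_le_one (fun v => by rw [act_one, real_inner_self_eq_norm_sq, one_mul]) hlog
    rw [hexp, measureReal_def, ← ENNReal.le_ofReal_iff_toReal_le (measure_ne_top _ _)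
      (by positivity), ← (measurePreserving_fst (μ := B) (ν := P.prod Q)).measure_preimage
        (measurableSet_lt (by fun_prop) (by fun_prop)).nullMeasurableSet] at h
    exact h
  have h₃ : (B.prod (P.prod Q)) {ω | E₃ ω.1 ω.2.1} ≤ ENNReal.ofReal (δ / 4) := by
    have hmp := (MeasurePreserving.id B).prod (measurePreserving_fst (μ := P) (ν := Q))
    exact hmp.measure_preimage_le _ |>.trans (tail B measurable_id)
  have h₄ : (B.prod (P.prod Q)) {ω | E₃ (act Uᵀ ω.2.2) ω.2.1} ≤ ENNReal.ofReal (δ / 4) := by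
    -- The query now plays the role of the independent source, so it must precede the
    -- demonstrations.
    have hmp := (Measure.measurePreserving_swap (μ := P) (ν := Q)).comp
      (measurePreserving_snd (μ := B) (ν := P.prod Q))
    exact hmp.measure_preimage_le _ |>.trans (tail Q (continuous_act Uᵀ).measurable)
  refine holdsWithProb_of_measure_not_le hδ.le ?_
  have hsub : {ω : Vec r × (Fin M → Vec d) × Vec d | ¬ ErrorBounds U V (c / M) (100 * c / κ)
      ((1 + 40 / √κ) ^ 2) L (nuisanceRate 4 (Vᵀ * Lam * V) r M δ + 4 / κ * ρ * √L)
      (R / √M + 1 / κ * ρ) ω.1 ω.2.1 ω.2.2}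
      ⊆ ({ω | (fun i => act Uᵀ (ω.2.1 i)) ∈ E₁} ∪ {ω | ω.1 ∈ E₂})
        ∪ ({ω | E₃ ω.1 ω.2.1} ∪ {ω | E₃ (act Uᵀ ω.2.2) ω.2.1}) := by
    rintro ⟨beta, X, x⟩ hω
    by_contra hcon
    simp only [Set.mem_union, Set.mem_ofPred_eq, not_or, E₁, E₂, E₃, not_not, not_lt] at hcon
    obtain ⟨⟨hZ, hβ⟩, hu, hz⟩ := hcon
    refine hω ?_
    replace hZ : ∀ v, √(κ * M) / 5 * ‖v‖ ≤ ‖act (conceptDesign U X) v‖ := hZ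
    have hs : 0 < √(κ * M) / 5 := by positivity
    have hρ0 : 0 ≤ ρ := (norm_nonneg _).trans hρ
    have hsM : 0 < √(M : ℝ) := Real.sqrt_pos.2 hMpos
    have hsκ : 0 < √κ := Real.sqrt_pos.2 hκ
    have hsplit : √(κ * M) = √κ * √M := Real.sqrt_mul hκ.le _
    have hβL : ‖beta‖ ≤ 4 * √L := by
      have h5 : √(r : ℝ) ≤ √L := Real.sqrt_le_sqrt (by linarith)
      have h6 : √(1 * Real.log (4 / δ)) ≤ √L := Real.sqrt_le_sqrt (by linarith)
      linarith
    have hhat : ∀ b : Vec r, ‖hatVec c b fun i => act Uᵀ (X i)‖ ≤ ‖b‖ / (√(κ * M) / 5) :=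
      norm_act_gramReg_inv_le (conceptDesign U X) hc hs hZ
    have hcross : ∀ b : Vec r, ‖∑ i, (hatVec c b fun i => act Uᵀ (X i)) i • act Wᵀ (X i)‖
          ≤ 2 * R * ‖hatVec c b fun i => act Uᵀ (X i)‖ →
        -- 10 = 2 · 5: the 2 from the Gaussian tail, the 5 from the singular value √(κM)/5.
        ‖crossVec U V X c b‖ ≤ 10 / √κ * (R / √M * ‖b‖) + 1 / κ * ρ * ‖b‖ := fun b hb => by
      calc _ ≤ _ := norm_crossVec_le hL V X hκ hc hκv b
        _ ≤ 2 * R * (‖b‖ / (√(κ * M) / 5)) + ρ * (‖b‖ / κ) := by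
            gcongr
            exact hb.trans (by gcongr; exact hhat b)
        _ = _ := by
            rw [hsplit]
            field_simp
            ring
    have hrate : nuisanceRate 4 (Vᵀ * Lam * V) r M δ = R / √M * √L := by
      rw [nuisanceRate, ← hR, Real.sqrt_div' _ hMpos.le]
      ring
    have hK : 0 ≤ 40 / √κ := by positivity
    -- K = 1 + 40/√κ, where 40 = 10 · 4 uses ‖β‖ ≤ 4√L. The summand 1 covers the ρ terms, whose
    -- constants 4/κ and 1/κ already sit in η and q.
    refine errorBounds_of_crossVec hUV hMpos hc hs (by linarith) (by rw [hrate]; positivity) hZ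
      ?_ ?_ ?_
    · calc c * (‖beta‖ / (√(κ * M) / 5) ^ 2) ≤ c * (4 * √L / (√(κ * M) / 5) ^ 2) := by gcongr
        _ = 100 * c / κ * (√L / M) := by
            rw [div_pow, Real.sq_sqrt (by positivity)]
            field_simp
            ring
    · refine (hcross beta hu).trans ?_
      rw [hrate]
      calc _ ≤ 10 / √κ * (R / √M * (4 * √L)) + 1 / κ * ρ * (4 * √L) := by gcongr
        _ = 40 / √κ * (R / √M * √L) + 1 * (4 / κ * ρ * √L) := by ring
        _ ≤ (1 + 40 / √κ) * (R / √M * √L) + (1 + 40 / √κ) * (4 / κ * ρ * √L) := by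
            gcongr <;> linarith
        _ = _ := by ring
    · refine (hcross _ hz).trans ?_
      have h10 : 10 / √κ ≤ 40 / √κ := by gcongr; norm_num
      calc _ = 10 / √κ * (R / √M * ‖act Uᵀ x‖) + 1 * (1 / κ * ρ * ‖act Uᵀ x‖) := by ring
        _ ≤ (1 + 40 / √κ) * (R / √M * ‖act Uᵀ x‖)
            + (1 + 40 / √κ) * (1 / κ * ρ * ‖act Uᵀ x‖) := by
            gcongr <;> linarith
        _ = _ := by ring
  calc _ ≤ _ := measure_mono hsub
    _ ≤ (ENNReal.ofReal (δ / 4) + ENNReal.ofReal (δ / 4))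
        + (ENNReal.ofReal (δ / 4) + ENNReal.ofReal (δ / 4)) :=
        (measure_union_le _ _).trans (add_le_add
          ((measure_union_le _ _).trans (add_le_add h₁ h₂))
          ((measure_union_le _ _).trans (add_le_add h₃ h₄)))
    _ = ENNReal.ofReal δ := by
        rw [← ENNReal.ofReal_add (by positivity) (by positivity),
          ← ENNReal.ofReal_add (by positivity) (by positivity)]
        congr 1
        ring

end

end ConceptICL

open ConceptICL in
theorem mainTheorem1 :
    ∃ a₀ : ℝ, 1 ≤ a₀ ∧
    ∀ κ lam₀ : ℝ, 0 < κ → 0 < lam₀ →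
    ∃ K₀ Kβ KΔ Kρ Kρ' : ℝ, 0 < K₀ ∧ 0 < Kβ ∧ 0 < KΔ ∧ 0 < Kρ ∧ 0 < Kρ' ∧
    ∀ (r d M : ℕ) (Lam : Matrix (Fin d) (Fin d) ℝ)
      (U : Matrix (Fin d) (Fin r) ℝ) (V : Matrix (Fin d) (Fin (d - r)) ℝ) (δ : ℝ),
      1 ≤ r → Lam.PosDef → IsOrthonormalComplement U V →
      -- `κ` is a lower bound for the least eigenvalue of `Λ₁₁`
      (Uᵀ * Lam * U - κ • (1 : Matrix (Fin r) (Fin r) ℝ)).PosSemidef →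
      0 < δ → δ < 1 →
      K₀ * effDim a₀ r δ ≤ M →
      -- exact block diagonality
      (Uᵀ * Lam * V = 0 →
        HoldsWithProb (dataLaw r d M Lam) δ fun ω =>
          ErrorBounds U V (lam₀ / M) Kβ KΔ (effDim a₀ r δ)
            (nuisanceRate a₀ (Vᵀ * Lam * V) r M δ)
            (nuisanceRadius a₀ (Vᵀ * Lam * V) δ / √M)
            ω.1 ω.2.1 ω.2.2) ∧
      -- near block diagonality
      (∀ ρ : ℝ, ‖Uᵀ * Lam * V‖ ≤ ρ →
        HoldsWithProb (dataLaw r d M Lam) δ fun ω =>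
          ErrorBounds U V (lam₀ / M) Kβ KΔ (effDim a₀ r δ)
            (nuisanceRate a₀ (Vᵀ * Lam * V) r M δ + Kρ * ρ * √(effDim a₀ r δ))
            (nuisanceRadius a₀ (Vᵀ * Lam * V) δ / √M + Kρ' * ρ)
            ω.1 ω.2.1 ω.2.2) := by
  refine ⟨4, by norm_num, fun κ c hκ hc => ⟨20, 100 * c / κ, (1 + 40 / √κ) ^ 2, 4 / κ, 1 / κ,
    by norm_num, by positivity, by positivity, by positivity, by positivity, ?_⟩⟩
  intro r d M Lam U V δ hr hL hUV hκL hδ hδ1 hM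
  have key := fun {ρ : ℝ} (hρ : ‖Uᵀ * Lam * V‖ ≤ ρ) =>
    holdsWithProb_errorBounds hκ hc hr hL.posSemidef hUV hκL hδ hδ1 hM hρ
  refine ⟨fun h0 => ?_, fun ρ hρ => key hρ⟩
  -- Block diagonality is the case ρ = 0, where both correction terms vanish.
  simpa using key (ρ := 0) (by rw [h0, norm_zero])
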